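/- Consider the $2\times2$ MIMO X channel with constant complex coefficients: transmitter $t$ has $M_t$ antennas, receiver $r$ has $N_r$ antennas ($r,t\in\{1,2\}$), the entries of the channel matrices $\mathbf H_{rt}\in\mathbb C^{N_r\times M_t}$ are i.i.d. circularly symmetric complex Gaussian, known everywhere and constant over time, and the noise entries are i.i.d. $\mathcal{CN}(0,1)$. Let $N_1\ge N_2\ge M_1\ge M_2\ge1$ and $N_1+N_2\ge 2M_1+M_2$. Put $$D=\begin{cases}M_1+M_2-1 & \text{if } N_2=M_1=M_2,\\ M_1+M_2-\tfrac12 & \text{if } N_2=M_1>M_2,\\ M_1+M_2 & \text{if } N_2>M_1,\end{cases}$$ and let the block lengths $Q_{rt}$ (number of real symbols from transmitter $t$ to receiver $r$) be $$(Q_{11},Q_{12},Q_{21},Q_{22})=\begin{cases}(2M_2-2,\;2M_2-2,\;1,\;1) & \text{if } N_2=M_1=M_2,\\ (2M_2-1,\;2M_2-1,\;2(N_2-M_2),\;1) & \text{if } N_2=M_1>M_2,\\ (2M_1-Q_{21},\;2M_2-Q_{22},\;\min\{2(N_2-M_2),M_1\},\;\min\{2(N_2-M_1),M_2\}) & \text{if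 } N_2>M_1.\end{cases}$$ All $Q_{rt}$ are at least $1$, except when $N_2=M_1=M_2=1$. An *alignment scheme* with block lengths $(Q_{rt})$ consists of complex precoding vectors $\mathbf p_{rt}^i\in\mathbb C^{M_t}$, $1\le i\le Q_{rt}$, one for each real symbol, and of numbers $a_r\le\min(Q_{r1},Q_{r2})$ such that, with $r'$ the receiver other than $r$: (i) $\mathbf H_{r'1}\mathbf p_{r1}^i=\mathbf H_{r'2}\mathbf p_{r2}^i$ for $i\le a_r$ (one-to-one alignment of interference at $r'$); (ii) at each receiver $r$ the vectors $\mathbf H_{rt}\mathbf p_{rt}^i$ ($t=1,2$, all $i$), $\mathbf H_{r1}\mathbf p_{r'1}^i$ (all $i$) and $\mathbf H_{r2}\mathbf p_{r'2}^i$ ($i>a_{r'}$) are linearly independent over $\mathbb R$. A message with rate $R(\rho)$ at power constraint $\rho$ has $\lim_{\rho\to\infty}R(\rho)/\log_2\rho$ degrees of freedom (DoF); DoF are achievable if such rates are achievable, for every $\rho>0$, by codes whose error probability tends to $0$ as their length grows. Then for almost every channel realization: 1. There is an alignment scheme with the above block lengths $(Q_{rt})$. If each symbol carries its own independent message, encoded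 separately into a sequence of real symbols that are multiplied by the symbol's precoding vector in each channel use, then $\tfrac12$ DoF is achievable for all messages simultaneously; the total is $D=\tfrac12(Q_{11}+Q_{12}+Q_{21}+Q_{22})$. 2. Every alignment scheme whose four block lengths are all at least $1$ satisfies $\tfrac12(Q_{11}+Q_{12}+Q_{21}+Q_{22})\le D$. 3. $M_1+M_2$ is an outer bound: no coding scheme whatsoever for the X channel achieves a total DoF greater than $M_1+M_2$. Thus the scheme attains the outer bound if $N_2>M_1$. -/

import Mathlib

open MeasureTheory ProbabilityTheory Filter Topology
open scoped NNReal

noncomputable section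

/-! Indexing: transmitters and receivers are `Fin 2`, so that index `0` is the first and index `1`
the second one. `M t` and `N r` are the numbers of antennas; the pair `(r, t)` always means
"receiver `r`, transmitter `t`", and `r.rev` is the receiver different from `r`. -/

/-- The circularly symmetric complex Gaussian law `CN(0, v)`. -/
def complexGaussian (v : ℝ≥0) : Measure ℂ :=
  ((gaussianReal 0 (v / 2)).prod (gaussianReal 0 (v / 2))).map
    Complex.measurableEquivRealProd.symm

instance (v : ℝ≥0) : IsProbabilityMeasure (complexGaussian v) :=
  Measure.isProbabilityMeasure_map Complex.measurableEquivRealProd.symm.measurable.aemeasurable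

/-- The constant channel coefficients: `H r t i j` is the gain from antenna `j` of transmitter `t`
to antenna `i` of receiver `r`. -/
abbrev Channel (M N : Fin 2 → ℕ) : Type :=
  ∀ r t : Fin 2, Fin (N r) → Fin (M t) → ℂ

/-- The law of the channel: all coefficients are i.i.d. `CN(0, v)`. -/
def channelLaw (M N : Fin 2 → ℕ) (v : ℝ≥0) : Measure (Channel M N) :=
  Measure.pi fun _ => Measure.pi fun _ => Measure.pi fun _ => Measure.pi fun _ =>
    complexGaussian v

/-- What receiver `r` sees (without noise) if transmitter `t` sends `x` in one channel use. -/
def Channel.apply {M N : Fin 2 → ℕ} (H : Channel M N) (r t : Fin 2) (x : Fin (M t) → ℂ) :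
    Fin (N r) → ℂ :=
  (Matrix.of (H r t)).mulVec x

/-! ### Linear precoding with aligned interference -/

/-- Precoding vectors: `P r t i` is the complex vector that multiplies the `i`-th real symbol of
the message block sent by transmitter `t` to receiver `r`; this block has `Q r t` symbols. -/
abbrev Precoders (M : Fin 2 → ℕ) (Q : Fin 2 → Fin 2 → ℕ) : Type :=
  ∀ r t : Fin 2, Fin (Q r t) → Fin (M t) → ℂ

/-- The columns that receiver `r` sees, where an aligned pair of interfering symbols counts once:
all columns of its own two blocks, all columns of the interfering block of the first
transmitter, and those columns of the interfering block of the second transmitter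
that are not aligned. -/
def receivedColumns {M N : Fin 2 → ℕ} {Q : Fin 2 → Fin 2 → ℕ} (H : Channel M N)
    (P : Precoders M Q) (a : Fin 2 → ℕ) (r : Fin 2) :
    ((t : Fin 2) × Fin (Q r t)) ⊕ (Fin (Q r.rev 0) ⊕ {i : Fin (Q r.rev 1) // a r.rev ≤ i}) →
      (Fin (N r) → ℂ) :=
  Sum.elim (fun s => H.apply r s.1 (P r s.1 s.2))
    (Sum.elim (fun i => H.apply r 0 (P r.rev 0 i)) (fun i => H.apply r 1 (P r.rev 1 i.1)))

/-- The interference alignment scheme. For each receiver `r`, the first `a r` symbols of the two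
blocks intended for `r` are aligned one-to-one at the other receiver, and at each receiver the
received columns are linearly independent over `ℝ` (asymmetric signaling: the symbols
are real, and `ℂ ^ N r` is a real space of dimension `2 * N r`). -/
structure IsAlignmentScheme {M N : Fin 2 → ℕ} {Q : Fin 2 → Fin 2 → ℕ} (H : Channel M N)
    (P : Precoders M Q) (a : Fin 2 → ℕ) : Prop where
  le_length : ∀ r t, a r ≤ Q r t
  aligned : ∀ (r : Fin 2) (i : Fin (a r)),
    H.apply r.rev 0 (P r 0 (Fin.castLE (le_length r 0) i)) =
      H.apply r.rev 1 (P r 1 (Fin.castLE (le_length r 1) i))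
  independent : ∀ r, LinearIndependent ℝ (receivedColumns H P a r)

/-! ### Codes, rates and degrees of freedom -/

/-- A code with `n` channel uses for the X channel in which transmitter `t` has `Q r t`
independent messages for receiver `r`, the `i`-th of which takes `size r t i` values. -/
structure Code (M N : Fin 2 → ℕ) (Q : Fin 2 → Fin 2 → ℕ) (n : ℕ) where
  size : ∀ r t : Fin 2, Fin (Q r t) → ℕ
  enc : ∀ t : Fin 2, (∀ (r : Fin 2) (i : Fin (Q r t)), Fin (size r t i)) →
    Fin n → Fin (M t) → ℂ
  dec : ∀ r : Fin 2, (Fin n → Fin (N r) → ℂ) →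
    ∀ (t : Fin 2) (i : Fin (Q r t)), Fin (size r t i)
  measurable_dec : ∀ r, Measurable (dec r)

/-- The law of the noise at the two receivers over `n` channel uses: i.i.d. `CN(0, 1)`. -/
def noiseLaw (N : Fin 2 → ℕ) (n : ℕ) : Measure (∀ r : Fin 2, Fin n → Fin (N r) → ℂ) :=
  Measure.pi fun _ => Measure.pi fun _ => Measure.pi fun _ => complexGaussian 1

namespace Code

variable {M N : Fin 2 → ℕ} {Q : Fin 2 → Fin 2 → ℕ} {n : ℕ}

/-- The tuples of all messages. -/
abbrev Messages (c : Code M N Q n) : Type :=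
  ∀ (r t : Fin 2) (i : Fin (Q r t)), Fin (c.size r t i)

/-- Every codeword of either transmitter has average power at most `ρ` per channel use. -/
def PowerConstraint (c : Code M N Q n) (ρ : ℝ) : Prop :=
  ∀ t w, ∑ k, ∑ j, ‖c.enc t w k j‖ ^ 2 ≤ n * ρ

/-- The signal at receiver `r` if the messages are `w` and the noise is `z`. -/
def received (c : Code M N Q n) (H : Channel M N) (w : c.Messages)
    (z : ∀ r : Fin 2, Fin n → Fin (N r) → ℂ) (r : Fin 2) : Fin n → Fin (N r) → ℂ :=
  fun k => ∑ t, H.apply r t (c.enc t (fun r' => w r' t) k) + z r k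

/-- The probability that some receiver decodes one of its messages wrongly, for independent
uniformly distributed messages. -/
def errorProb (c : Code M N Q n) (H : Channel M N) : ℝ :=
  (∑ w : c.Messages, (noiseLaw N n).real {z | ∃ r, c.dec r (c.received H w z r) ≠ w r}) /
    Fintype.card c.Messages

/-- The code uses the precoders `P`: each message is encoded on its own into a sequence of real
symbols, and in each channel use every symbol is multiplied by its precoding vector. -/
def UsesPrecoders (c : Code M N Q n) (P : Precoders M Q) : Prop :=
  ∃ book : ∀ (r t : Fin 2) (i : Fin (Q r t)), Fin (c.size r t i) → Fin n → ℝ,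
    ∀ t w k, c.enc t w k = ∑ r, ∑ i, ((book r t i (w r i) k : ℝ) : ℂ) • P r t i

end Code

/-- The rates `R r t i` (in bits per channel use) are achievable at power `ρ` by codes from the
class `C`: such codes exist for all large `n`, with error probability tending to zero. -/
def RatesAchievable {M N : Fin 2 → ℕ} {Q : Fin 2 → Fin 2 → ℕ} (H : Channel M N)
    (C : ∀ n, Set (Code M N Q n)) (ρ : ℝ) (R : ∀ r t : Fin 2, Fin (Q r t) → ℝ) : Prop :=
  ∀ ε > 0, ∃ n₀ : ℕ, ∀ n ≥ n₀, ∃ c ∈ C n, c.PowerConstraint ρ ∧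
    (∀ r t i, (2 : ℝ) ^ ((n : ℝ) * R r t i) ≤ c.size r t i) ∧ c.errorProb H ≤ ε

/-- The degrees of freedom `d r t i` of the messages, `d = lim R(ρ) / log₂ ρ`, are simultaneously
achievable by codes from the class `C`. -/
def DoFAchievable {M N : Fin 2 → ℕ} {Q : Fin 2 → Fin 2 → ℕ} (H : Channel M N)
    (C : ∀ n, Set (Code M N Q n)) (d : ∀ r t : Fin 2, Fin (Q r t) → ℝ) : Prop :=
  ∃ R : ℝ → ∀ r t : Fin 2, Fin (Q r t) → ℝ,
    (∀ ρ > 0, RatesAchievable H C ρ (R ρ)) ∧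
    ∀ r t i, Tendsto (fun ρ => R ρ r t i / Real.logb 2 ρ) atTop (𝓝 (d r t i))

/-! ### The values -/

/-- The lengths of the message blocks, row = receiver, column = transmitter. -/
def blockLength (M N : Fin 2 → ℕ) : Fin 2 → Fin 2 → ℕ :=
  if N 1 = M 0 ∧ M 0 = M 1 then
    ![![2 * M 1 - 2, 2 * M 1 - 2],
      ![1, 1]]
  else if N 1 = M 0 then
    ![![2 * M 1 - 1, 2 * M 1 - 1],
      ![2 * (N 1 - M 1), 1]]
  else
    ![![2 * M 0 - min (2 * (N 1 - M 1)) (M 0), 2 * M 1 - min (2 * (N 1 - M 0)) (M 1)],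
      ![min (2 * (N 1 - M 1)) (M 0), min (2 * (N 1 - M 0)) (M 1)]]

/-- The total degrees of freedom. -/
def totalDoF (M N : Fin 2 → ℕ) : ℝ :=
  if N 1 = M 0 ∧ M 0 = M 1 then (M 0 : ℝ) + M 1 - 1
  else if N 1 = M 0 then (M 0 : ℝ) + M 1 - 1 / 2
  else (M 0 : ℝ) + M 1

end

/-! Outer bound. It holds for every channel and uses no entropy. Let the receivers cooperate: each
message tuple then has one joint decoding region, and these regions are disjoint. Compare each
codeword with a random Gaussian input of variance `ρ` per antenna. The output law of a codeword is
at most `(C * ρ ^ (M 0 + M 1)) ^ n` times the output law of the Gaussian input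
(`GaussianShift.translate_le`); the power of `ρ` is the inverse mass that the Gaussian input gives
to a unit ball. Summing over the disjoint regions, the number of message tuples times the success
probability is at most this constant (`Code.card_messages_mul_le`).

Achievability. Real linear independence of the received columns gives, for each symbol, a real
functional of the output that annihilates all other symbols
(`IsAlignmentScheme.exists_zeroForcing`), so each symbol has its own scalar real channel. About `ρ ^
(1 / 2 - δ / 2)` levels at a distance of order `ρ ^ (δ / 2)` respect the power constraint, and
rounding to the nearest level rarely fails at high power. A Gilbert-Varshamov code corrects the
small fraction of failures at a small loss of rate. This gives nearly `(1 / 2) * log₂ ρ` bits per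
symbol.

Existence. All rank conditions needed (`Channel.IsGeneric`) say that some determinant, polynomial in
the channel, is nonzero; they hold almost everywhere because they hold for one channel with entries
`0` and `1`. If `N 1 > M 0`, the kernels of the joint channels supply the aligned pairs. No nonzero
signal can be aligned at both receivers, so at each transmitter the two aligned families are jointly
independent and extend to a real basis of the whole signal space; independence at the receivers is
then a dimension count. If `N 1 = M 0`, the channel from transmitter `0` to receiver `1` is
invertible, and every signal of transmitter `1` has an aligned partner.

Optimality. The symbols of a transmitter fit into its space, and at receiver `1` the desired symbols
together with the interference from either transmitter fit into the receiver's space. When `N 1 = M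
0`, nonempty blocks for receiver `1` make these inequalities lose one or two symbols
(`IsAlignmentScheme.sum_length_le`). -/

open scoped ENNReal

/-! ### Translates of Gaussian measures -/

/-- The density of the translate of `μ` by `s` with respect to `μ` is `exp (L s z - q s)`, as for a
centred Gaussian measure with covariance form `L` and energy `q`. -/
structure GaussianShift {E : Type*} [AddGroup E] [MeasurableSpace E] (μ : Measure E)
    (L : E → E → ℝ) (q : E → ℝ) : Prop where
  measurable_pairing : ∀ s, Measurable (L s)
  neg_pairing : ∀ s z, L (-s) z = -L s z
  neg_energy : ∀ s, q (-s) = q s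
  abs_pairing_le : ∀ s z, |L s z| ≤ q s + q z
  lintegral_add : ∀ (s : E) (f : E → ℝ≥0∞), Measurable f →
    ∫⁻ z, f (z + s) ∂μ = ∫⁻ z, f z * ENNReal.ofReal (Real.exp (L s z - q s)) ∂μ

theorem gaussianShift_gaussianReal {w : ℝ≥0} (hw : w ≠ 0) :
    GaussianShift (gaussianReal 0 w) (fun s z => s * z / w) (fun s => s ^ 2 / (2 * w)) where
  measurable_pairing s := by fun_prop
  neg_pairing s z := by ring
  neg_energy s := by ring
  abs_pairing_le s z := by
    have hw' : (0 : ℝ) < w := by positivity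
    rw [abs_le]
    constructor
    · have : 0 ≤ (s + z) ^ 2 / (2 * w) := by positivity
      have h : (s + z) ^ 2 / (2 * w) = s ^ 2 / (2 * w) + z ^ 2 / (2 * w) + s * z / w := by
        field_simp; ring
      linarith
    · have : 0 ≤ (s - z) ^ 2 / (2 * w) := by positivity
      have h : (s - z) ^ 2 / (2 * w) = s ^ 2 / (2 * w) + z ^ 2 / (2 * w) - s * z / w := by
        field_simp; ring
      linarith
  lintegral_add s f hf := by
    have hw' : (0 : ℝ) < w := by positivity
    rw [← lintegral_map (f := f) (g := (· + s)) hf (measurable_add_const s),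
      gaussianReal_map_add_const, gaussianReal_of_var_ne_zero _ hw,
      gaussianReal_of_var_ne_zero _ hw,
      lintegral_withDensity_eq_lintegral_mul _ (measurable_gaussianPDF _ _) hf,
      lintegral_withDensity_eq_lintegral_mul _ (measurable_gaussianPDF _ _) (by fun_prop)]
    refine lintegral_congr fun z => ?_
    simp only [Pi.mul_apply, gaussianPDF]
    rw [mul_comm (f z), ← mul_assoc, ← ENNReal.ofReal_mul (gaussianPDFReal_nonneg _ _ _)]
    congr 2
    simp only [gaussianPDFReal]
    rw [mul_assoc _ (Real.exp _) (Real.exp _), ← Real.exp_add]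
    congr 2
    field_simp
    ring

theorem GaussianShift.prod {E F : Type*} [AddGroup E] [AddGroup F] [MeasurableSpace E]
    [MeasurableSpace F] [MeasurableAdd₂ E] [MeasurableAdd₂ F] {μ : Measure E} {ν : Measure F}
    [SFinite μ] [SFinite ν]
    {L : E → E → ℝ} {q : E → ℝ} {L' : F → F → ℝ} {q' : F → ℝ}
    (h : GaussianShift μ L q) (h' : GaussianShift ν L' q') :
    GaussianShift (μ.prod ν) (fun s z => L s.1 z.1 + L' s.2 z.2) (fun s => q s.1 + q' s.2) where
  measurable_pairing s :=
    ((h.measurable_pairing _).comp measurable_fst).add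
      ((h'.measurable_pairing _).comp measurable_snd)
  neg_pairing s z := by
    simp only [Prod.fst_neg, Prod.snd_neg, h.neg_pairing, h'.neg_pairing]; ring
  neg_energy s := by simp only [Prod.fst_neg, Prod.snd_neg, h.neg_energy, h'.neg_energy]
  abs_pairing_le s z := (abs_add_le _ _).trans (by
    linarith [h.abs_pairing_le s.1 z.1, h'.abs_pairing_le s.2 z.2])
  lintegral_add s f hf := by
    have m1 := h.measurable_pairing s.1
    have m2 := h'.measurable_pairing s.2
    have m3 : Measurable fun z : E × F => f (z + s) :=
      hf.comp ((measurable_fst.add_const s.1).prodMk (measurable_snd.add_const s.2))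
    rw [lintegral_prod _ m3.aemeasurable, lintegral_prod _ (by fun_prop)]
    have e1 : ∀ x : E, ∫⁻ y, f ((x, y) + s) ∂ν =
        ∫⁻ y, f (x + s.1, y) * ENNReal.ofReal (Real.exp (L' s.2 y - q' s.2)) ∂ν := fun x =>
      h'.lintegral_add s.2 (fun y => f (x + s.1, y)) (by fun_prop)
    simp only [e1]
    rw [h.lintegral_add s.1
      (fun x => ∫⁻ y, f (x, y) * ENNReal.ofReal (Real.exp (L' s.2 y - q' s.2)) ∂ν)
      (Measurable.lintegral_prod_right' (f := fun p : E × F =>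
        f p * ENNReal.ofReal (Real.exp (L' s.2 p.2 - q' s.2))) (by fun_prop))]
    refine lintegral_congr fun x => ?_
    rw [← lintegral_mul_const _ (by fun_prop)]
    refine lintegral_congr fun y => ?_
    rw [mul_assoc, ← ENNReal.ofReal_mul (by positivity), ← Real.exp_add]
    congr 3
    ring

theorem GaussianShift.map {E F : Type*} [AddGroup E] [AddGroup F] [MeasurableSpace E]
    [MeasurableSpace F] [MeasurableAdd F] {μ : Measure E} {L : E → E → ℝ} {q : E → ℝ}
    (h : GaussianShift μ L q) (e : E ≃ᵐ F) (he : ∀ x y, e (x + y) = e x + e y) :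
    GaussianShift (μ.map e) (fun s z => L (e.symm s) (e.symm z)) (fun s => q (e.symm s)) := by
  have hneg : ∀ s, e.symm (-s) = -e.symm s := fun s => by
    let g : E →+ F := AddMonoidHom.mk' e he
    apply e.injective
    have : e (-e.symm s) = -e (e.symm s) := map_neg g _
    rw [this, e.apply_symm_apply, e.apply_symm_apply]
  refine ⟨fun s => (h.measurable_pairing _).comp e.symm.measurable, fun s z => ?_, fun s => ?_,
    fun s z => h.abs_pairing_le _ _, fun s f hf => ?_⟩
  · simp only [hneg, h.neg_pairing]
  · simp only [hneg, h.neg_energy]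
  · have m1 := h.measurable_pairing (e.symm s)
    have m2 := e.symm.measurable
    have m3 := e.measurable
    rw [lintegral_map (by fun_prop) m3, lintegral_map (by fun_prop) m3]
    have := h.lintegral_add (e.symm s) (fun x => f (e x)) (by fun_prop)
    simpa [he] using this

theorem GaussianShift.pi {n : ℕ} {E : Fin n → Type*} [∀ i, AddGroup (E i)]
    [∀ i, MeasurableSpace (E i)] [∀ i, MeasurableAdd₂ (E i)] {μ : ∀ i, Measure (E i)}
    [∀ i, SigmaFinite (μ i)] {L : ∀ i, E i → E i → ℝ} {q : ∀ i, E i → ℝ}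
    (h : ∀ i, GaussianShift (μ i) (L i) (q i)) :
    GaussianShift (Measure.pi μ) (fun s z => ∑ i, L i (s i) (z i)) (fun s => ∑ i, q i (s i)) := by
  induction n with
  | zero =>
    refine ⟨fun s => by simp, fun s z => by simp, fun s => by simp, fun s z => by simp,
      fun s f hf => ?_⟩
    simp [Subsingleton.elim (_ : ∀ i : Fin 0, E i) 0]
  | succ n ih =>
    have h1 := ((h 0).prod (ih (E := fun i => E (Fin.succAbove 0 i))
      (μ := fun i => μ (Fin.succAbove 0 i)) fun i => h (Fin.succAbove 0 i))).map
      (MeasurableEquiv.piFinSuccAbove E 0).symm (fun x y => by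
        apply (MeasurableEquiv.piFinSuccAbove E 0).injective
        rw [MeasurableEquiv.apply_symm_apply]
        rfl)
    rw [(measurePreserving_piFinSuccAbove μ 0).symm.map_eq] at h1
    convert h1 using 3 <;> exact Fin.sum_univ_succ _

/-- The translates by `s` and `-s` have densities `exp (±L - q)`, whose sum is `2 * exp (-q) * cosh
L`, and `cosh ≥ 1`. Symmetrizing thus removes the linear term, whose sign is not controlled. -/
theorem GaussianShift.two_mul_le {E : Type*} [AddGroup E] [MeasurableSpace E] {μ : Measure E}
    {L : E → E → ℝ} {q : E → ℝ} (h : GaussianShift μ L q) (s : E) {f : E → ℝ≥0∞}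
    (hf : Measurable f) :
    2 * (ENNReal.ofReal (Real.exp (-q s)) * ∫⁻ z, f z ∂μ) ≤
      ∫⁻ z, f (z + s) ∂μ + ∫⁻ z, f (z + -s) ∂μ := by
  have m1 := h.measurable_pairing s
  rw [h.lintegral_add s f hf, h.lintegral_add (-s) f hf, ← lintegral_add_left (by fun_prop),
    ← lintegral_const_mul _ hf, ← lintegral_const_mul _ (by fun_prop)]
  refine lintegral_mono fun z => ?_
  rw [h.neg_pairing, h.neg_energy, ← mul_add, ← mul_assoc, mul_comm _ (f z)]
  refine mul_le_mul' le_rfl ?_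
  rw [← ENNReal.ofReal_add (by positivity) (by positivity), ← ENNReal.ofReal_ofNat,
    ← ENNReal.ofReal_mul (by norm_num)]
  refine ENNReal.ofReal_le_ofReal ?_
  have h1 : Real.exp (L s z - q s) = Real.exp (-q s) * Real.exp (L s z) := by
    rw [← Real.exp_add]; congr 1; ring
  have h2 : Real.exp (-L s z - q s) = Real.exp (-q s) * Real.exp (-L s z) := by
    rw [← Real.exp_add]; congr 1; ring
  rw [h1, h2, ← mul_add, mul_comm]
  refine mul_le_mul_of_nonneg_left ?_ (by positivity)
  have := Real.one_le_cosh (L s z)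
  rw [Real.cosh_eq] at this
  linarith

/-- The law of a translated Gaussian vector is dominated by its mixture over Gaussian
translations. -/
theorem GaussianShift.translate_le {E X : Type*} [AddCommGroup E] [MeasurableSpace E]
    [MeasurableAdd₂ E] [AddCommGroup X] [MeasurableSpace X] [MeasurableAdd₂ X] [MeasurableNeg X]
    {ν : Measure E} {γ : Measure X} [SFinite ν] [γ.IsNegInvariant]
    {L : E → E → ℝ} {q : E → ℝ} {L' : X → X → ℝ} {q' : X → ℝ}
    (hν : GaussianShift ν L q) (hγ : GaussianShift γ L' q') (G : X →+ E) (hG : Measurable G)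
    {B : Set X} (hB : MeasurableSet B) (hBneg : ∀ v, -v ∈ B ↔ v ∈ B) {b c : ℝ}
    (hb : ∀ v ∈ B, q' v ≤ b) (hc : ∀ v ∈ B, q (G v) ≤ c) {A : Set E} (hA : MeasurableSet A)
    (x : X) :
    ENNReal.ofReal (Real.exp (-(2 * q' x + b + c))) * γ B * ν {z | z + G x ∈ A} ≤
      ∫⁻ u, ν {z | z + G u ∈ A} ∂γ := by
  set h : X → ℝ≥0∞ := fun u => ν {z | z + G u ∈ A} with hh
  have hmeas : Measurable h :=
    measurable_measure_prodMk_left (ν := ν) (s := {p : X × E | p.2 + G p.1 ∈ A})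
      (hA.preimage (measurable_snd.add (hG.comp measurable_fst)))
  have hmeas' : Measurable fun v => h (v + x) := hmeas.comp (measurable_add_const x)
  have hint : ∀ u, h u = ∫⁻ z, A.indicator 1 (z + G u) ∂ν := fun u => by
    exact (lintegral_indicator_one (μ := ν) (hA.preimage (measurable_add_const (G u)))).symm
  -- Perturbing the input `x` by `v` and by `-v` moves the output by `±G v`, which costs only the
  -- factor `exp (-c)` after averaging over the sign.
  have hsym : ∀ v ∈ B, 2 * (ENNReal.ofReal (Real.exp (-c)) * h x) ≤ h (v + x) + h (-v + x) := by
    intro v hv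
    have h0 := hν.two_mul_le (G v) (f := fun z => A.indicator 1 (z + G x))
      ((measurable_one.indicator hA).comp (measurable_add_const _))
    rw [← hint] at h0
    rw [hint (v + x), hint (-v + x)]
    simp only [map_add, map_neg, ← add_assoc]
    refine le_trans ?_ h0
    gcongr
    exact hc v hv
  -- Both `B` and `γ` are symmetric, so the two signs contribute equally.
  have hneg : ∫⁻ v in B, h (-v + x) ∂γ = ∫⁻ v in B, h (v + x) ∂γ := by
    rw [← lintegral_indicator hB, ← lintegral_indicator hB,
      ← lintegral_neg_eq_self (B.indicator fun v => h (v + x))]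
    refine lintegral_congr fun v => ?_
    by_cases hv : v ∈ B
    · rw [Set.indicator_of_mem hv, Set.indicator_of_mem ((hBneg v).2 hv)]
    · rw [Set.indicator_of_notMem hv, Set.indicator_of_notMem (mt (hBneg v).1 hv)]
  have hB1 : ENNReal.ofReal (Real.exp (-c)) * h x * γ B ≤ ∫⁻ v in B, h (v + x) ∂γ := by
    have h0 : ∫⁻ _ in B, 2 * (ENNReal.ofReal (Real.exp (-c)) * h x) ∂γ ≤
        ∫⁻ v in B, (h (v + x) + h (-v + x)) ∂γ := setLIntegral_mono' hB hsym
    rw [lintegral_add_left hmeas', hneg, setLIntegral_const,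
      ← two_mul, mul_assoc] at h0
    exact (ENNReal.mul_le_mul_iff_right (by norm_num) (by norm_num)).1 h0
  have hmain : ∫⁻ u, h u ∂γ =
      ∫⁻ v, h (v + x) * ENNReal.ofReal (Real.exp (L' (-x) v - q' (-x))) ∂γ := by
    rw [← hγ.lintegral_add (-x) (fun v => h (v + x)) hmeas']
    simp
  -- Recentring `γ` at `x` brings in a density. On `B` its exponent is at least `-(q' x + q' v) - q'
  -- x ≥ -(2 * q' x + b)`.
  have hlow : ∀ v ∈ B, ENNReal.ofReal (Real.exp (-(2 * q' x + b))) * h (v + x) ≤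
      h (v + x) * ENNReal.ofReal (Real.exp (L' (-x) v - q' (-x))) := by
    intro v hv
    rw [mul_comm]
    gcongr
    have h1 := (abs_le.1 (hγ.abs_pairing_le (-x) v)).1
    have h2 := hb v hv
    rw [hγ.neg_energy] at h1 ⊢
    linarith
  calc ENNReal.ofReal (Real.exp (-(2 * q' x + b + c))) * γ B * h x
      = ENNReal.ofReal (Real.exp (-(2 * q' x + b))) *
          (ENNReal.ofReal (Real.exp (-c)) * h x * γ B) := by
        rw [neg_add (2 * q' x + b), Real.exp_add, ENNReal.ofReal_mul (by positivity)]
        ring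
    _ ≤ ENNReal.ofReal (Real.exp (-(2 * q' x + b))) * ∫⁻ v in B, h (v + x) ∂γ := by gcongr
    _ = ∫⁻ v in B, ENNReal.ofReal (Real.exp (-(2 * q' x + b))) * h (v + x) ∂γ := by
        rw [lintegral_const_mul _ hmeas']
    _ ≤ ∫⁻ v in B, h (v + x) * ENNReal.ofReal (Real.exp (L' (-x) v - q' (-x))) ∂γ :=
        setLIntegral_mono' hB hlow
    _ ≤ ∫⁻ u, h u ∂γ := (setLIntegral_le_lintegral _ _).trans hmain.ge

/-! ### Complex Gaussian blocks -/

theorem gaussianShift_complexGaussian {v : ℝ≥0} (hv : v ≠ 0) :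
    GaussianShift (complexGaussian v)
      (fun s z => s.re * z.re / (v / 2 : ℝ≥0) + s.im * z.im / (v / 2 : ℝ≥0))
      (fun s => ‖s‖ ^ 2 / v) := by
  have hw : v / 2 ≠ 0 := by simpa using hv
  have h := ((gaussianShift_gaussianReal hw).prod (gaussianShift_gaussianReal hw)).map
    Complex.measurableEquivRealProd.symm (fun x y => by
      apply Complex.ext <;> simp [Complex.measurableEquivRealProd])
  refine (congrArg (GaussianShift _ _) (funext fun s => ?_)).mp h
  have hv' : (0 : ℝ) < v := by positivity
  rw [← Complex.normSq_eq_norm_sq, Complex.normSq_apply]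
  simp only [MeasurableEquiv.symm_symm, Complex.measurableEquivRealProd_apply]
  push_cast
  field_simp

instance isNegInvariant_complexGaussian (v : ℝ≥0) : (complexGaussian v).IsNegInvariant where
  neg_eq_self := by
    have h : (gaussianReal 0 (v / 2)).map Neg.neg = gaussianReal 0 (v / 2) := by
      simpa using gaussianReal_map_neg (μ := 0) (v := v / 2)
    rw [Measure.neg_def, complexGaussian,
      Measure.map_map measurable_neg Complex.measurableEquivRealProd.symm.measurable]
    conv_rhs => rw [← h, Measure.map_prod_map _ _ measurable_neg measurable_neg,
      Measure.map_map Complex.measurableEquivRealProd.symm.measurable (by fun_prop)]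
    rfl

/-- The square of side `1` about the origin lies in the unit disc. On it each real coordinate, of
variance `v / 2`, has density at least `exp (-1 / 2) / √(π v)`, because `x ^ 2 / v ≤ 1 / 2` for `v ≥
1`. -/
theorem le_complexGaussian_closedBall {v : ℝ≥0} (hv : 1 ≤ v) :
    ENNReal.ofReal (Real.exp (-1) / (Real.pi * v)) ≤
      complexGaussian v (Metric.closedBall 0 1) := by
  have hw : v / 2 ≠ 0 := by have := (zero_lt_one.trans_le hv).ne'; simpa using this
  have hv' : (1 : ℝ) ≤ v := by exact_mod_cast hv
  have hreal : ENNReal.ofReal (Real.exp (-(1 / 2)) / √(Real.pi * v)) ≤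
      gaussianReal 0 (v / 2) (Set.Icc (-(1 / 2)) (1 / 2)) := by
    rw [gaussianReal_apply _ hw]
    have hvol : volume (Set.Icc (-(1 / 2) : ℝ) (1 / 2)) = 1 := by
      rw [Real.volume_Icc]; norm_num
    calc _ = ∫⁻ _ in Set.Icc (-(1 / 2) : ℝ) (1 / 2),
          ENNReal.ofReal (Real.exp (-(1 / 2)) / √(Real.pi * v)) := by
          rw [setLIntegral_const, hvol, mul_one]
      _ ≤ _ := by
          refine setLIntegral_mono' measurableSet_Icc fun x hx => ?_
          refine ENNReal.ofReal_le_ofReal ?_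
          have e : (2 : ℝ) * Real.pi * (v / 2 : ℝ≥0) = Real.pi * v := by push_cast; ring
          rw [gaussianPDFReal, e, div_eq_inv_mul]
          refine mul_le_mul_of_nonneg_left (Real.exp_le_exp.2 ?_) (by positivity)
          have e2 : (2 : ℝ) * (v / 2 : ℝ≥0) = v := by push_cast; ring
          rw [e2, sub_zero, neg_div, neg_le_neg_iff, div_le_iff₀ (by positivity)]
          have : x ^ 2 ≤ 1 / 2 := by nlinarith [hx.1, hx.2]
          linarith
  rw [complexGaussian, MeasurableEquiv.map_apply]
  calc ENNReal.ofReal (Real.exp (-1) / (Real.pi * v))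
      = ENNReal.ofReal (Real.exp (-(1 / 2)) / √(Real.pi * v)) *
          ENNReal.ofReal (Real.exp (-(1 / 2)) / √(Real.pi * v)) := by
        rw [← ENNReal.ofReal_mul (by positivity), div_mul_div_comm, ← Real.exp_add,
          Real.mul_self_sqrt (by positivity)]
        norm_num
    _ ≤ _ := mul_le_mul' hreal hreal
    _ = _ := (Measure.prod_prod _ _).symm
    _ ≤ _ := by
        refine measure_mono fun p hp => ?_
        obtain ⟨h1, h2⟩ := hp
        rw [Set.mem_preimage, mem_closedBall_zero_iff]
        refine (Complex.norm_le_abs_re_add_abs_im _).trans ?_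
        have h3 : |p.1| ≤ 1 / 2 := abs_le.2 h1
        have h4 : |p.2| ≤ 1 / 2 := abs_le.2 h2
        have e1 : (Complex.measurableEquivRealProd.symm p).re = p.1 := rfl
        have e2 : (Complex.measurableEquivRealProd.symm p).im = p.2 := rfl
        rw [e1, e2]
        linarith

/-- The law of a block of `n` uses of independent complex Gaussian vectors. -/
noncomputable def gaussianBlock (N : Fin 2 → ℕ) (n : ℕ) (v : ℝ≥0) :
    Measure (∀ r : Fin 2, Fin n → Fin (N r) → ℂ) :=
  Measure.pi fun _ => Measure.pi fun _ => Measure.pi fun _ => complexGaussian v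

instance (N : Fin 2 → ℕ) (n : ℕ) (v : ℝ≥0) : IsProbabilityMeasure (gaussianBlock N n v) := by
  unfold gaussianBlock; infer_instance

instance (N : Fin 2 → ℕ) (n : ℕ) : IsProbabilityMeasure (noiseLaw N n) := by
  unfold noiseLaw; infer_instance

instance (N : Fin 2 → ℕ) (n : ℕ) (v : ℝ≥0) : (gaussianBlock N n v).IsNegInvariant := by
  have h1 (r : Fin 2) : (Measure.pi fun _ : Fin (N r) => complexGaussian v).IsNegInvariant :=
    inferInstance
  have h2 (r : Fin 2) : (Measure.pi fun _ : Fin n =>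
    Measure.pi fun _ : Fin (N r) => complexGaussian v).IsNegInvariant := inferInstance
  exact Measure.pi.isNegInvariant _

theorem gaussianShift_gaussianBlock (N : Fin 2 → ℕ) (n : ℕ) {v : ℝ≥0} (hv : v ≠ 0) :
    ∃ L, GaussianShift (gaussianBlock N n v) L (fun s => ∑ r, ∑ k, ∑ j, ‖s r k j‖ ^ 2 / v) :=
  ⟨_, GaussianShift.pi fun _ => GaussianShift.pi fun _ => GaussianShift.pi fun _ =>
    gaussianShift_complexGaussian hv⟩

/-- The norm is the sup norm, so the ball is a product of discs. Applied to the inputs, this bound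
produces the exponent `M 0 + M 1` of the power. -/
theorem le_gaussianBlock_closedBall (N : Fin 2 → ℕ) (n : ℕ) {v : ℝ≥0} (hv : 1 ≤ v) :
    ENNReal.ofReal (((Real.exp (-1) / (Real.pi * v)) ^ (N 0 + N 1)) ^ n) ≤
      gaussianBlock N n v (Metric.closedBall 0 1) := by
  have hpos : 0 ≤ Real.exp (-1) / (Real.pi * v) := by positivity
  rw [gaussianBlock, Measure.pi_closedBall _ _ zero_le_one]
  simp only [Pi.zero_apply, Measure.pi_closedBall _ _ zero_le_one, Finset.prod_const,
    Finset.card_univ, Fintype.card_fin, Fin.prod_univ_two]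
  rw [← mul_pow, ← pow_add, ENNReal.ofReal_pow (by positivity), ENNReal.ofReal_pow hpos]
  gcongr
  exact le_complexGaussian_closedBall hv

/-! ### The outer bound -/

/-- The noiseless channel over `n` uses. -/
def Channel.block {M N : Fin 2 → ℕ} (H : Channel M N) (n : ℕ) :
    (∀ t : Fin 2, Fin n → Fin (M t) → ℂ) →+ (∀ r : Fin 2, Fin n → Fin (N r) → ℂ) where
  toFun x r k := ∑ t, H.apply r t (x t k)
  map_zero' := by ext; simp [Channel.apply]
  map_add' x y := by
    ext r k j
    simp only [Channel.apply, Pi.add_apply, Matrix.mulVec_add, Finset.sum_add_distrib]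

theorem Channel.measurable_block {M N : Fin 2 → ℕ} (H : Channel M N) (n : ℕ) :
    Measurable (H.block n) := by
  refine measurable_pi_lambda _ fun r => measurable_pi_lambda _ fun k =>
    measurable_pi_lambda _ fun j => ?_
  have : (fun x : ∀ t : Fin 2, Fin n → Fin (M t) → ℂ => H.block n x r k j) =
      fun x => ∑ t, ∑ i, H r t j i * x t k i := by
    ext x
    simp [Channel.block, Channel.apply, Matrix.mulVec, dotProduct]
  rw [this]
  fun_prop

theorem Channel.norm_block_le {M N : Fin 2 → ℕ} (H : Channel M N) {n : ℕ}
    {x : ∀ t : Fin 2, Fin n → Fin (M t) → ℂ} (hx : ‖x‖ ≤ 1) (r : Fin 2) (k : Fin n)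
    (j : Fin (N r)) : ‖H.block n x r k j‖ ≤ ∑ t, ∑ i, ‖H r t j i‖ := by
  have h : H.block n x r k j = ∑ t, ∑ i, H r t j i * x t k i := by
    simp [Channel.block, Channel.apply, Matrix.mulVec, dotProduct]
  rw [h]
  refine (norm_sum_le _ _).trans (Finset.sum_le_sum fun t _ => (norm_sum_le _ _).trans
    (Finset.sum_le_sum fun i _ => ?_))
  rw [norm_mul]
  refine mul_le_of_le_one_right (norm_nonneg _) ?_
  exact ((norm_le_pi_norm (x t k) i).trans ((norm_le_pi_norm (x t) k).trans
    (norm_le_pi_norm x t))).trans hx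

theorem sum_sq_norm_le_of_norm_le_one {M : Fin 2 → ℕ} {n : ℕ}
    {x : ∀ t : Fin 2, Fin n → Fin (M t) → ℂ} (hx : ‖x‖ ≤ 1) :
    ∑ t, ∑ k, ∑ i, ‖x t k i‖ ^ 2 ≤ n * ((M 0 + M 1 : ℕ) : ℝ) := by
  have h : ∀ t k i, ‖x t k i‖ ^ 2 ≤ 1 := fun t k i =>
    pow_le_one₀ (norm_nonneg _) (((norm_le_pi_norm (x t k) i).trans
      ((norm_le_pi_norm (x t) k).trans (norm_le_pi_norm x t))).trans hx)
  calc _ ≤ ∑ t, ∑ _k : Fin n, ∑ _i : Fin (M t), (1 : ℝ) :=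
        Finset.sum_le_sum fun t _ => Finset.sum_le_sum fun k _ => Finset.sum_le_sum fun i _ =>
          h t k i
    _ = _ := by
      rw [Fin.sum_univ_two]
      simp
      ring

namespace Code

variable {M N : Fin 2 → ℕ} {Q : Fin 2 → Fin 2 → ℕ} {n : ℕ}

/-- The outputs that are decoded as the messages `w`. -/
def decodingRegion (c : Code M N Q n) (w : c.Messages) :
    Set (∀ r : Fin 2, Fin n → Fin (N r) → ℂ) :=
  {y | ∀ r, c.dec r (y r) = w r}

theorem measurableSet_decodingRegion (c : Code M N Q n) (w : c.Messages) :
    MeasurableSet (c.decodingRegion w) := by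
  have : c.decodingRegion w = ⋂ r, (fun y => c.dec r (y r)) ⁻¹' {w r} := by
    ext y; simp [decodingRegion]
  rw [this]
  exact MeasurableSet.iInter fun r =>
    (measurableSet_singleton (w r)).preimage ((c.measurable_dec r).comp (measurable_pi_apply r))

theorem pairwise_disjoint_decodingRegion (c : Code M N Q n) :
    Pairwise (Function.onFun Disjoint c.decodingRegion) := by
  intro w w' hne
  refine Set.disjoint_left.2 fun y hy hy' => hne ?_
  funext r
  rw [← hy r, hy' r]

theorem received_eq (c : Code M N Q n) (H : Channel M N) (w : c.Messages)
    (z : ∀ r : Fin 2, Fin n → Fin (N r) → ℂ) :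
    c.received H w z = z + H.block n (fun t => c.enc t fun r => w r t) := by
  ext r k j
  simp [received, Channel.block, add_comm]

/-- Every code has at most about `ρ ^ (n * (M 0 + M 1))` message tuples. -/
theorem card_messages_mul_le (H : Channel M N) :
    ∃ C > 0, ∀ (Q : Fin 2 → Fin 2 → ℕ) (n : ℕ) (c : Code M N Q n) (ρ : ℝ), 1 ≤ ρ →
      c.PowerConstraint ρ → 0 < Fintype.card c.Messages →
      Fintype.card c.Messages * (1 - c.errorProb H) ≤ (C * ρ ^ (M 0 + M 1)) ^ n := by
  set S : ℝ := ∑ r, ∑ j, (∑ t, ∑ i, ‖H r t j i‖) ^ 2 with hS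
  -- Exponential costs per channel use: `4` is twice the scaled energy `≤ 2` of a codeword of both
  -- transmitters, `M 0 + M 1` bounds the energy of a perturbation in the unit ball, and `S` the
  -- energy of its image at the receivers.
  set E : ℝ := 4 + ((M 0 + M 1 : ℕ) : ℝ) + S with hE
  refine ⟨Real.exp E * (Real.pi / Real.exp (-1)) ^ (M 0 + M 1), by positivity,
    fun Q n c ρ hρ hP hcard => ?_⟩
  have hρ0 : 0 < ρ := zero_lt_one.trans_le hρ
  -- With input variance `ρ` the codewords have scaled energy of order `n`, whatever the power is.
  set v : ℝ≥0 := ⟨ρ, hρ0.le⟩ with hv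
  have hvρ : (v : ℝ) = ρ := rfl
  have hv1 : 1 ≤ v := hρ
  obtain ⟨L, hL⟩ := gaussianShift_gaussianBlock N n one_ne_zero
  obtain ⟨L', hL'⟩ := gaussianShift_gaussianBlock M n (zero_lt_one.trans_le hv1).ne'
  set B : Set (∀ t : Fin 2, Fin n → Fin (M t) → ℂ) := Metric.closedBall 0 1 with hB
  set K : ℝ := (Real.exp (-1) / (Real.pi * ρ)) ^ (M 0 + M 1) with hK
  have hK0 : 0 < K := by positivity
  have henergy : ∀ x : ∀ t : Fin 2, Fin n → Fin (M t) → ℂ,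
      ∑ t, ∑ k, ∑ i, ‖x t k i‖ ^ 2 / (v : ℝ) = (∑ t, ∑ k, ∑ i, ‖x t k i‖ ^ 2) / ρ := fun x => by
    simp only [Finset.sum_div, hvρ]
  have hone : ∀ w, ENNReal.ofReal ((Real.exp (-E) * K) ^ n) *
      noiseLaw N n {z | c.received H w z ∈ c.decodingRegion w} ≤
      ∫⁻ u, noiseLaw N n {z | z + H.block n u ∈ c.decodingRegion w} ∂gaussianBlock M n v := by
    intro w
    have h := hL.translate_le hL' (H.block n) (H.measurable_block n) (B := B)
      measurableSet_closedBall (fun u => by simp [hB])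
      (b := n * ((M 0 + M 1 : ℕ) : ℝ)) (c := n * S) (fun u hu => ?_) (fun u hu => ?_)
      (c.measurableSet_decodingRegion w) (fun t => c.enc t fun r => w r t)
    · simp only [received_eq]
      refine le_trans ?_ h
      refine mul_le_mul' ?_ le_rfl
      refine le_trans ?_ (mul_le_mul' le_rfl (le_gaussianBlock_closedBall M n hv1))
      rw [← ENNReal.ofReal_mul (by positivity), hvρ, mul_pow]
      refine ENNReal.ofReal_le_ofReal (mul_le_mul_of_nonneg_right ?_ (by positivity))
      rw [← Real.exp_nat_mul]
      refine Real.exp_le_exp.2 ?_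
      have hx : (∑ t, ∑ k, ∑ i, ‖c.enc t (fun r => w r t) k i‖ ^ 2) / ρ ≤ 2 * n := by
        rw [div_le_iff₀ hρ0, Fin.sum_univ_two]
        linarith [hP 0 fun r => w r 0, hP 1 fun r => w r 1]
      have he := henergy fun t => c.enc t fun r => w r t
      simp only [hvρ] at he
      rw [he, hE]
      linarith
    · rw [henergy, div_le_iff₀ hρ0]
      have h1 := sum_sq_norm_le_of_norm_le_one (mem_closedBall_zero_iff.1 hu)
      refine h1.trans (le_mul_of_one_le_right (by positivity) hρ)
    · have h1 := fun r k j => H.norm_block_le (mem_closedBall_zero_iff.1 hu) r k j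
      simp only [NNReal.coe_one, div_one]
      calc _ ≤ ∑ r, ∑ _k : Fin n, ∑ j, (∑ t, ∑ i, ‖H r t j i‖) ^ 2 :=
            Finset.sum_le_sum fun r _ => Finset.sum_le_sum fun k _ => Finset.sum_le_sum fun j _ =>
              pow_le_pow_left₀ (norm_nonneg _) (h1 r k j) 2
        _ = n * S := by simp [hS]; ring
  -- The dominating measure does not depend on `w`, and the decoding regions are disjoint: for each
  -- fixed `u` the probabilities sum to at most `1`.
  have hsum : ∑ w, ENNReal.ofReal ((Real.exp (-E) * K) ^ n) *
      noiseLaw N n {z | c.received H w z ∈ c.decodingRegion w} ≤ 1 := by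
    refine (Finset.sum_le_sum fun w _ => hone w).trans ?_
    have hm : ∀ w, Measurable fun u : ∀ t : Fin 2, Fin n → Fin (M t) → ℂ =>
        noiseLaw N n {z | z + H.block n u ∈ c.decodingRegion w} := fun w =>
      measurable_measure_prodMk_left (ν := noiseLaw N n)
        (s := {p : (∀ t : Fin 2, Fin n → Fin (M t) → ℂ) × (∀ r : Fin 2, Fin n → Fin (N r) → ℂ) |
          p.2 + H.block n p.1 ∈ c.decodingRegion w})
        ((c.measurableSet_decodingRegion w).preimage
          (measurable_snd.add ((H.measurable_block n).comp measurable_fst)))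
    rw [← lintegral_finsetSum _ fun w _ => hm w]
    refine (lintegral_mono (g := fun _ => 1) fun u => ?_).trans (by simp)
    refine (measure_biUnion_finset (s := Finset.univ)
      (f := fun w => {z | z + H.block n u ∈ c.decodingRegion w}) (fun w _ w' _ hne => ?_)
      fun w _ => (c.measurableSet_decodingRegion w).preimage
        (measurable_add_const (H.block n u))).symm.trans_le ?_
    · exact (c.pairwise_disjoint_decodingRegion hne).preimage _
    · exact prob_le_one
  have hreal : (Real.exp (-E) * K) ^ n *
      ∑ w, (noiseLaw N n).real {z | c.received H w z ∈ c.decodingRegion w} ≤ 1 := by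
    have h := ENNReal.toReal_mono ENNReal.one_ne_top hsum
    rw [← Finset.mul_sum, ENNReal.toReal_mul, ENNReal.toReal_ofReal (by positivity),
      ENNReal.toReal_sum fun w _ => measure_ne_top _ _, ENNReal.toReal_one] at h
    exact h
  have herr : Fintype.card c.Messages * (1 - c.errorProb H) =
      ∑ w, (noiseLaw N n).real {z | c.received H w z ∈ c.decodingRegion w} := by
    have hc : (Fintype.card c.Messages : ℝ) ≠ 0 := by positivity
    have h1 : ∀ w, (noiseLaw N n).real {z | c.received H w z ∈ c.decodingRegion w} =
        1 - (noiseLaw N n).real {z | ∃ r, c.dec r (c.received H w z r) ≠ w r} := fun w => by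
      have hm : MeasurableSet {z | c.received H w z ∈ c.decodingRegion w} := by
        simp only [received_eq]
        exact (c.measurableSet_decodingRegion w).preimage (measurable_add_const _)
      rw [← probReal_compl_eq_one_sub₀ (NullMeasurableSet.compl_iff.1 ?_)]
      · congr 1
        ext z
        simp [decodingRegion]
      · have : {z | ∃ r, c.dec r (c.received H w z r) ≠ w r}ᶜ =
            {z | c.received H w z ∈ c.decodingRegion w} := by
          ext z
          simp [decodingRegion]
        rw [this]
        exact hm.nullMeasurableSet
    simp only [h1, Finset.sum_sub_distrib, errorProb]
    field_simp
    simp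
  rw [herr]
  have hpos : 0 < (Real.exp (-E) * K) ^ n := by positivity
  rw [mul_comm, ← le_div_iff₀ hpos] at hreal
  refine hreal.trans_eq ?_
  rw [one_div, ← inv_pow]
  congr 1
  rw [mul_inv, ← Real.exp_neg, neg_neg, hK, ← inv_pow, inv_div, mul_assoc, ← mul_pow]
  congr 2
  ring

end Code

/-- No codes achieve more degrees of freedom than there are transmit antennas. -/
theorem sum_le_of_doFAchievable {M N : Fin 2 → ℕ} (H : Channel M N) {Q : Fin 2 → Fin 2 → ℕ}
    {C : ∀ n, Set (Code M N Q n)} {d : ∀ r t, Fin (Q r t) → ℝ} (h : DoFAchievable H C d) :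
    ∑ r, ∑ t, ∑ i, d r t i ≤ (M 0 : ℝ) + M 1 := by
  obtain ⟨R, hR, hlim⟩ := h
  obtain ⟨K, hK, hcard⟩ := Code.card_messages_mul_le H
  have hbound : ∀ ρ : ℝ, 1 ≤ ρ → ∑ r, ∑ t, ∑ i, R ρ r t i ≤
      Real.logb 2 K + (M 0 + M 1 : ℕ) * Real.logb 2 ρ := by
    intro ρ hρ
    have hρ0 : 0 < ρ := zero_lt_one.trans_le hρ
    set s := ∑ r, ∑ t, ∑ i, R ρ r t i with hs
    -- Error probability `1 / 2` is enough: it costs one bit in total, which disappears on dividing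
    -- by `n → ∞` at fixed power.
    obtain ⟨n₀, hn₀⟩ := hR ρ hρ0 (1 / 2) (by norm_num)
    have hn : ∀ n ≥ n₀, n * s ≤ 1 + n * (Real.logb 2 K + (M 0 + M 1 : ℕ) * Real.logb 2 ρ) := by
      intro n hn
      obtain ⟨c, -, hP, hrate, herr⟩ := hn₀ n hn
      have hprod : (2 : ℝ) ^ ((n : ℝ) * s) ≤ Fintype.card c.Messages := by
        simp only [hs, Finset.mul_sum, Fintype.card_pi, Fintype.card_fin, Nat.cast_prod]
        simp only [Real.rpow_sum_of_pos two_pos]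
        refine Finset.prod_le_prod (fun _ _ => by positivity) fun r _ => ?_
        refine Finset.prod_le_prod (fun _ _ => by positivity) fun t _ => ?_
        exact Finset.prod_le_prod (fun _ _ => by positivity) fun i _ => hrate r t i
      have hpos : (0 : ℝ) < Fintype.card c.Messages := lt_of_lt_of_le (by positivity) hprod
      have h1 := hcard Q n c ρ hρ hP (by exact_mod_cast hpos)
      have h2 : (2 : ℝ) ^ ((n : ℝ) * s) ≤ 2 * (K * ρ ^ (M 0 + M 1)) ^ n := by
        refine hprod.trans ?_
        nlinarith
      have h3 := Real.logb_le_logb_of_le one_lt_two (by positivity) h2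
      rw [Real.logb_rpow two_pos (by norm_num), Real.logb_mul (by norm_num) (by positivity),
        Real.logb_self_eq_one one_lt_two, Real.logb_pow,
        Real.logb_mul hK.ne' (by positivity), Real.logb_pow] at h3
      exact h3
    by_contra! hlt
    set δ := s - (Real.logb 2 K + (M 0 + M 1 : ℕ) * Real.logb 2 ρ) with hδ
    have hδ0 : 0 < δ := sub_pos.2 hlt
    obtain ⟨m, hm⟩ := exists_nat_gt (1 / δ)
    have hbig := hn (max m n₀) (le_max_right _ _)
    have hmm : (m : ℝ) ≤ (max m n₀ : ℕ) := by exact_mod_cast le_max_left _ _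
    rw [div_lt_iff₀ hδ0] at hm
    nlinarith
  have hlogtop : Tendsto (fun ρ => Real.logb 2 ρ) atTop atTop := Real.tendsto_logb_atTop one_lt_two
  have h1 : Tendsto (fun ρ => ∑ r, ∑ t, ∑ i, R ρ r t i / Real.logb 2 ρ) atTop
      (𝓝 (∑ r, ∑ t, ∑ i, d r t i)) :=
    tendsto_finsetSum _ fun r _ => tendsto_finsetSum _ fun t _ => tendsto_finsetSum _ fun i _ =>
      hlim r t i
  have h2 : Tendsto (fun ρ => Real.logb 2 K / Real.logb 2 ρ + (M 0 + M 1 : ℕ)) atTop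
      (𝓝 (0 + (M 0 + M 1 : ℕ))) :=
    (hlogtop.const_div_atTop _).add_const _
  rw [zero_add] at h2
  push_cast at h2
  refine le_of_tendsto_of_tendsto h1 h2 ?_
  filter_upwards [eventually_gt_atTop 1] with ρ hρ
  have hl : 0 < Real.logb 2 ρ := Real.logb_pos one_lt_two hρ
  simp only [← Finset.sum_div]
  rw [div_le_iff₀ hl, add_mul, div_mul_cancel₀ _ hl.ne']
  exact_mod_cast hbound ρ hρ.le

/-! ### Error-correcting codes -/

/-- A word in the ball is determined by the set of changed positions, one of at most `2 ^ n`, and by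
the new entries there, at most `K ^ d` choices. -/
theorem card_hammingBall_le {n K : ℕ} (hK : 1 ≤ K) (x : Fin n → Fin K) (d : ℕ) :
    (Finset.univ.filter fun y => hammingDist x y ≤ d).card ≤ 2 ^ n * K ^ d := by
  classical
  have hsub : (Finset.univ.filter fun y => hammingDist x y ≤ d) ⊆
      (Finset.univ.filter fun S : Finset (Fin n) => S.card ≤ d).biUnion fun S =>
        Fintype.piFinset fun k => if k ∈ S then Finset.univ else {x k} := by
    intro y hy
    rw [Finset.mem_filter] at hy
    rw [Finset.mem_biUnion]
    refine ⟨Finset.univ.filter fun k => x k ≠ y k, by simpa [hammingDist] using hy.2, ?_⟩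
    rw [Fintype.mem_piFinset]
    intro k
    by_cases h : x k = y k <;> simp [h]
  refine (Finset.card_le_card hsub).trans (Finset.card_biUnion_le.trans ?_)
  calc _ ≤ ∑ _S ∈ Finset.univ.filter fun S : Finset (Fin n) => S.card ≤ d, K ^ d := by
        refine Finset.sum_le_sum fun S hS => ?_
        rw [Fintype.card_piFinset]
        have : ∀ k, (if k ∈ S then (Finset.univ : Finset (Fin K)) else {x k}).card =
            if k ∈ S then K else 1 := fun k => by split_ifs <;> simp
        simp only [this]
        rw [Finset.prod_ite_mem, Finset.univ_inter, Finset.prod_const]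
        exact Nat.pow_le_pow_right hK (Finset.mem_filter.1 hS).2
    _ ≤ 2 ^ n * K ^ d := by
        rw [Finset.sum_const, smul_eq_mul]
        refine Nat.mul_le_mul_right _ ((Finset.card_filter_le _ _).trans ?_)
        simp

/-- The Gilbert-Varshamov bound. -/
theorem exists_finset_hammingDist_lt {n K : ℕ} (hK : 1 ≤ K) (d : ℕ) :
    ∃ C : Finset (Fin n → Fin K), (∀ x ∈ C, ∀ y ∈ C, x ≠ y → d < hammingDist x y) ∧
      K ^ n ≤ C.card * (2 ^ n * K ^ d) := by
  classical
  -- A largest code with the required distance cannot be enlarged, so the balls of radius `d` about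
  -- its words cover everything.
  obtain ⟨C, hC, hmax⟩ := Finset.exists_max_image
    (Finset.univ.filter fun C : Finset (Fin n → Fin K) =>
      ∀ x ∈ C, ∀ y ∈ C, x ≠ y → d < hammingDist x y) Finset.card ⟨∅, by simp⟩
  rw [Finset.mem_filter] at hC
  refine ⟨C, hC.2, ?_⟩
  have hcover : (Finset.univ : Finset (Fin n → Fin K)) ⊆
      C.biUnion fun x => Finset.univ.filter fun y => hammingDist x y ≤ d := by
    intro y _
    by_contra hy
    simp only [Finset.mem_biUnion, Finset.mem_filter, Finset.mem_univ, true_and, not_exists,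
      not_and, not_le] at hy
    have hyC : y ∉ C := fun h => by simpa using hy y h
    have := hmax (insert y C) (by
      simp only [Finset.mem_filter, Finset.mem_univ, true_and, Finset.mem_insert]
      rintro a (rfl | ha) b (rfl | hb) hab
      · exact absurd rfl hab
      · rw [hammingDist_comm]; exact hy b hb
      · exact hy a ha
      · exact hC.2 a ha b hb hab)
    rw [Finset.card_insert_of_notMem hyC] at this
    omega
  calc K ^ n = (Finset.univ : Finset (Fin n → Fin K)).card := by simp
    _ ≤ _ := Finset.card_le_card hcover
    _ ≤ ∑ x ∈ C, (Finset.univ.filter fun y => hammingDist x y ≤ d).card := Finset.card_biUnion_le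
    _ ≤ ∑ _x ∈ C, 2 ^ n * K ^ d := Finset.sum_le_sum fun x _ => card_hammingBall_le hK x d
    _ = _ := by rw [Finset.sum_const, smul_eq_mul]

theorem exists_decoder_of_hammingDist {n K e m : ℕ} (hm : 0 < m) (word : Fin m → Fin n → Fin K)
    (hd : ∀ w w', w ≠ w' → 2 * e < hammingDist (word w) (word w')) :
    ∃ dec : (Fin n → Fin K) → Fin m, ∀ w y, hammingDist (word w) y ≤ e → dec y = w := by
  classical
  refine ⟨fun y => if h : ∃ w, hammingDist (word w) y ≤ e then h.choose else ⟨0, hm⟩,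
    fun w y hw => ?_⟩
  have h : ∃ w, hammingDist (word w) y ≤ e := ⟨w, hw⟩
  simp only [h, dif_pos]
  by_contra hne
  have h1 := hd _ _ hne
  have h2 := hammingDist_triangle (word h.choose) y (word w)
  rw [hammingDist_comm y] at h2
  have h3 := h.choose_spec
  omega

theorem exists_measurable_quantizer {K : ℕ} (hK : 1 ≤ K) {s : ℝ} (hs : 0 < s) :
    ∃ quant : ℝ → Fin K, Measurable quant ∧
      ∀ (j : Fin K) (z : ℝ), |z| < s / 2 → quant (s * (j : ℕ) + z) = j := by
  -- Rounding to the nearest level. Truncation at `K - 1` and the value `0` of the natural floor at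
  -- negative numbers make the map total; they do not interfere when the noise is small.
  refine ⟨fun x => ⟨min ⌊x / s + 1 / 2⌋₊ (K - 1), by omega⟩, ?_, fun j z hz => ?_⟩
  · have h : Measurable fun x : ℝ => ⌊x / s + 1 / 2⌋₊ :=
      Nat.measurable_floor.comp (by fun_prop)
    exact (measurable_of_countable fun k : ℕ => (⟨min k (K - 1), by omega⟩ : Fin K)).comp h
  · have h1 := abs_lt.1 hz
    have hfloor : ⌊(s * (j : ℕ) + z) / s + 1 / 2⌋₊ = (j : ℕ) := by
      have e : (s * (j : ℕ) + z) / s + 1 / 2 = (j : ℕ) + (z / s + 1 / 2) := by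
        field_simp
        ring
      rw [e]
      have h2 : -(1 / 2) < z / s := by rw [lt_div_iff₀ hs]; linarith
      have h3 : z / s < 1 / 2 := by rw [div_lt_iff₀ hs]; linarith
      rw [Nat.floor_eq_iff (by have := Nat.cast_nonneg (α := ℝ) (j : ℕ); linarith)]
      constructor <;> linarith
    ext
    simp only [hfloor]
    have := j.2
    omega

/-- Block codes for a real channel with additive noise that correct `e` large noise samples. -/
theorem exists_real_blockCode {n K : ℕ} (hK : 1 ≤ K) {s : ℝ} (hs : 0 < s) (e : ℕ) :
    ∃ (m : ℕ) (word : Fin m → Fin n → ℝ) (dec : (Fin n → ℝ) → Fin m),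
      K ^ n ≤ m * (2 ^ n * K ^ (2 * e)) ∧ (∀ w k, |word w k| ≤ s * K) ∧ Measurable dec ∧
      ∀ w (z : Fin n → ℝ), (Finset.univ.filter fun k => s / 2 ≤ |z k|).card ≤ e →
        dec (fun k => word w k + z k) = w := by
  -- Distance greater than `2 * e` corrects `e` wrong positions. A position can be wrong only where
  -- the noise reaches half of the spacing.
  obtain ⟨C, hC, hcard⟩ := exists_finset_hammingDist_lt (n := n) hK (2 * e)
  have hm : 0 < C.card := by
    by_contra h
    have h0 : C.card = 0 := by omega
    rw [h0, zero_mul] at hcard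
    have := Nat.pow_pos (n := n) hK
    omega
  obtain ⟨dec, hdec⟩ := exists_decoder_of_hammingDist (e := e) hm
    (fun w => (C.equivFin.symm w : Fin n → Fin K)) fun w w' hne =>
      hC _ (C.equivFin.symm w).2 _ (C.equivFin.symm w').2 fun h =>
        hne (C.equivFin.symm.injective (Subtype.ext h))
  obtain ⟨quant, hq, hquant⟩ := exists_measurable_quantizer hK hs
  refine ⟨C.card, fun w k => s * ((C.equivFin.symm w : Fin n → Fin K) k : ℕ),
    fun y => dec fun k => quant (y k), hcard, fun w k => ?_, ?_, fun w z hz => ?_⟩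
  · rw [abs_of_nonneg (by positivity)]
    exact mul_le_mul_of_nonneg_left (by exact_mod_cast (Fin.is_lt _).le) hs.le
  · exact (measurable_of_countable dec).comp
      (measurable_pi_lambda _ fun k => hq.comp (measurable_pi_apply k))
  · refine hdec w _ (le_trans (Finset.card_le_card fun k hk => ?_) hz)
    simp only [Finset.mem_filter, Finset.mem_univ, true_and] at hk ⊢
    by_contra! h
    exact hk (hquant _ _ h).symm

/-! ### Zero forcing -/

/-- The symbols intended for a receiver are recovered linearly from the noiseless output. -/
theorem IsAlignmentScheme.exists_zeroForcing {M N : Fin 2 → ℕ} {Q : Fin 2 → Fin 2 → ℕ}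
    {H : Channel M N} {P : Precoders M Q} {a : Fin 2 → ℕ} (h : IsAlignmentScheme H P a)
    (r t : Fin 2) (i : Fin (Q r t)) :
    ∃ l : (Fin (N r) → ℂ) →ₗ[ℝ] ℝ, ∀ u : ∀ r t, Fin (Q r t) → ℝ,
      l (∑ t', H.apply r t' (∑ r', ∑ i', ((u r' t' i' : ℝ) : ℂ) • P r' t' i')) = u r t i := by
  classical
  -- A left inverse reads off the coefficients of the independent received columns; `l` is the
  -- coordinate belonging to the wanted symbol.
  obtain ⟨g, hg⟩ := (Finsupp.linearCombination ℝ (receivedColumns H P a r)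
    ).exists_leftInverse_of_injective (LinearMap.ker_eq_bot.2 (h.independent r))
  have hgv : ∀ j, g (receivedColumns H P a r j) = Finsupp.single j 1 := fun j => by
    have := LinearMap.congr_fun hg (Finsupp.single j 1)
    simpa using this
  set l : (Fin (N r) → ℂ) →ₗ[ℝ] ℝ := Finsupp.lapply (Sum.inl ⟨t, i⟩) ∘ₗ g with hl
  have hown : ∀ t' i', l (H.apply r t' (P r t' i')) =
      if (⟨t', i'⟩ : (t : Fin 2) × Fin (Q r t)) = ⟨t, i⟩ then 1 else 0 := fun t' i' => by
    have := hgv (Sum.inl ⟨t', i'⟩)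
    simp only [receivedColumns, Sum.elim_inl] at this
    simp [hl, this, Finsupp.single_apply]
  have hint0 : ∀ i', l (H.apply r 0 (P r.rev 0 i')) = 0 := fun i' => by
    have := hgv (Sum.inr (Sum.inl i'))
    simp only [receivedColumns, Sum.elim_inl, Sum.elim_inr] at this
    simp [hl, this]
  have hint1 : ∀ i', l (H.apply r 1 (P r.rev 1 i')) = 0 := fun i' => by
    by_cases hi : a r.rev ≤ i'
    · have := hgv (Sum.inr (Sum.inr ⟨i', hi⟩))
      simp only [receivedColumns, Sum.elim_inr] at this
      simp [hl, this]
    -- An aligned column of transmitter `1` is not listed, but it equals a listed interfering column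
    -- of transmitter `0`, which `l` annihilates.
    · have h1 := h.aligned r.rev ⟨i', not_le.1 hi⟩
      rw [Fin.rev_rev] at h1
      exact (congrArg l h1).symm.trans (hint0 _)
  have hint : ∀ t' i', l (H.apply r t' (P r.rev t' i')) = 0 := fun t' =>
    match t' with
    | 0 => hint0
    | 1 => hint1
  refine ⟨l, fun u => ?_⟩
  have hsmul : ∀ (t' : Fin 2) (c : ℝ) (x : Fin (M t') → ℂ),
      l (H.apply r t' ((c : ℂ) • x)) = c * l (H.apply r t' x) := fun t' c x => by
    rw [Channel.apply, Matrix.mulVec_smul, ← smul_eq_mul, ← map_smul]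
    rfl
  have hexp : ∀ t', l (H.apply r t' (∑ r', ∑ i', ((u r' t' i' : ℝ) : ℂ) • P r' t' i')) =
      ∑ r', ∑ i', u r' t' i' * l (H.apply r t' (P r' t' i')) := fun t' => by
    simp only [← hsmul]
    simp only [Channel.apply, Matrix.mulVec_sum, map_sum]
  have hrev : ∀ f : Fin 2 → ℝ, ∑ r', f r' = f r + f r.rev := fun f => by
    rw [Fin.sum_univ_two]
    fin_cases r
    · rfl
    · exact add_comm _ _
  have hstream : ∀ t', l (H.apply r t' (∑ r', ∑ i', ((u r' t' i' : ℝ) : ℂ) • P r' t' i')) =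
      ∑ i', u r t' i' * if (⟨t', i'⟩ : (t : Fin 2) × Fin (Q r t)) = ⟨t, i⟩ then 1 else 0 := by
    intro t'
    rw [hexp, hrev]
    simp only [hown, hint, mul_zero, Finset.sum_const_zero, add_zero]
  rw [map_sum]
  simp only [hstream]
  rw [← Fintype.sum_sigma' (f := fun t' i' => u r t' i' *
    if (⟨t', i'⟩ : (t : Fin 2) × Fin (Q r t)) = ⟨t, i⟩ then 1 else 0)]
  simp

/-! ### Achievability -/

/-- Union bound over the at most `2 ^ n` sets of more than `e` bad times. The noise is independent
over time, so each set has probability at most the `(e + 1)`-st power of that of one bad time. -/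
theorem noiseLaw_setOf_lt_card_le (N : Fin 2 → ℕ) (n e : ℕ) (r : Fin 2)
    (A : Set (Fin (N r) → ℂ)) [DecidablePred (· ∈ A)] :
    noiseLaw N n {z | e < (Finset.univ.filter fun k => z r k ∈ A).card} ≤
      2 ^ n * (Measure.pi fun _ : Fin (N r) => complexGaussian 1) A ^ (e + 1) := by
  classical
  set p := (Measure.pi fun _ : Fin (N r) => complexGaussian 1) A with hp
  have hone : ∀ S : Finset (Fin n), noiseLaw N n {z | ∀ k ∈ S, z r k ∈ A} = p ^ S.card := by
    intro S
    have hset : {z : ∀ r : Fin 2, Fin n → Fin (N r) → ℂ | ∀ k ∈ S, z r k ∈ A} =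
        Set.pi Set.univ (Function.update (fun _ => Set.univ) r
          (Set.pi Set.univ fun k => if k ∈ S then A else Set.univ)) := by
      ext z
      simp only [Set.mem_ofPred_eq, Set.mem_univ_pi]
      constructor
      · intro h r'
        by_cases hr : r' = r
        · subst hr
          rw [Function.update_self, Set.mem_univ_pi]
          intro k
          by_cases hk : k ∈ S
          · simpa [hk] using h k hk
          · simp [hk]
        · rw [Function.update_of_ne hr]
          trivial
      · intro h k hk
        have := h r
        rw [Function.update_self, Set.mem_univ_pi] at this
        simpa [hk] using this k
    rw [hset, noiseLaw, Measure.pi_pi, Finset.prod_eq_single r, Function.update_self,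
      Measure.pi_pi]
    · have : ∀ k, (Measure.pi fun _ : Fin (N r) => complexGaussian 1)
          (if k ∈ S then A else Set.univ) = if k ∈ S then p else 1 := fun k => by
        split_ifs
        · rfl
        · exact measure_univ
      simp only [this]
      rw [Finset.prod_ite_mem, Finset.univ_inter, Finset.prod_const]
    · intro r' _ hr
      rw [Function.update_of_ne hr]
      exact measure_univ
    · simp
  have hsub : {z : ∀ r : Fin 2, Fin n → Fin (N r) → ℂ |
      e < (Finset.univ.filter fun k => z r k ∈ A).card} ⊆
      ⋃ S ∈ Finset.univ.filter fun S : Finset (Fin n) => e < S.card,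
        {z | ∀ k ∈ S, z r k ∈ A} := by
    intro z hz
    simp only [Set.mem_iUnion]
    exact ⟨_, Finset.mem_filter.2 ⟨Finset.mem_univ _, hz⟩, fun k hk => (Finset.mem_filter.1 hk).2⟩
  refine (measure_mono hsub).trans ((measure_biUnion_finset_le _ _).trans ?_)
  calc _ ≤ ∑ _S ∈ Finset.univ.filter fun S : Finset (Fin n) => e < S.card, p ^ (e + 1) := by
        refine Finset.sum_le_sum fun S hS => ?_
        rw [hone]
        exact pow_le_pow_right_of_le_one' prob_le_one (Finset.mem_filter.1 hS).2
    _ ≤ 2 ^ n * p ^ (e + 1) := by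
        rw [Finset.sum_const, nsmul_eq_mul]
        refine mul_le_mul' ?_ le_rfl
        have : (Finset.univ.filter fun S : Finset (Fin n) => e < S.card).card ≤ 2 ^ n :=
          (Finset.card_filter_le _ _).trans (by simp)
        exact_mod_cast this

/-- Pulse amplitude modulation with `K` levels at distance `s`, zero forcing and block codes for
the separate symbols. -/
theorem IsAlignmentScheme.exists_code {M N : Fin 2 → ℕ} {Q : Fin 2 → Fin 2 → ℕ}
    {H : Channel M N} {P : Precoders M Q} {a : Fin 2 → ℕ} (h : IsAlignmentScheme H P a) :
    ∃ B : ℝ, 0 < B ∧ ∃ l : ∀ r t : Fin 2, Fin (Q r t) → (Fin (N r) → ℂ) →ₗ[ℝ] ℝ,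
      ∀ (n K e : ℕ) (s ρ : ℝ), 1 ≤ K → 0 < s → (s * K) ^ 2 * B ≤ ρ →
        ∃ c : Code M N Q n, c.UsesPrecoders P ∧ c.PowerConstraint ρ ∧
          (∀ r t i, K ^ n ≤ c.size r t i * (2 ^ n * K ^ (2 * e))) ∧
          ∀ w z, (∀ r t i, (Finset.univ.filter fun k => s / 2 ≤ |l r t i (z r k)|).card ≤ e) →
            ∀ r, c.dec r (c.received H w z r) = w r := by
  choose l hl using h.exists_zeroForcing
  -- If all symbols are at most `s * K`, the energy of a transmitter per channel use is at most `(s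
  -- * K) ^ 2 * B`. The summand `1` makes `B` positive.
  set B : ℝ := 1 + ∑ t, ∑ j, (∑ r, ∑ i, ‖P r t i j‖) ^ 2 with hB
  refine ⟨B, by positivity, l, fun n K e s ρ hK hs hρ => ?_⟩
  obtain ⟨m, word, dec, hcard, hword, hmeas, hdec⟩ := exists_real_blockCode (n := n) hK hs e
  refine ⟨{ size := fun _ _ _ => m
            enc := fun t w k => ∑ r, ∑ i, ((word (w r i) k : ℝ) : ℂ) • P r t i
            dec := fun r y t i => dec fun k => l r t i (y k)
            measurable_dec := fun r => measurable_pi_lambda _ fun t => measurable_pi_lambda _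
              fun i => hmeas.comp (measurable_pi_lambda _ fun k =>
                (l r t i).continuous_of_finiteDimensional.measurable.comp
                  (measurable_pi_apply k)) },
    ⟨fun _ _ _ => word, fun _ _ _ => rfl⟩, fun t w => ?_, fun _ _ _ => hcard,
    fun w z hz r => ?_⟩
  · have hcoord : ∀ k j, ‖(∑ r, ∑ i, ((word (w r i) k : ℝ) : ℂ) • P r t i) j‖ ≤
        s * K * ∑ r, ∑ i, ‖P r t i j‖ := by
      intro k j
      simp only [Finset.sum_apply, Pi.smul_apply, Finset.mul_sum]
      refine (norm_sum_le _ _).trans (Finset.sum_le_sum fun r _ => (norm_sum_le _ _).trans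
        (Finset.sum_le_sum fun i _ => ?_))
      rw [norm_smul, Complex.norm_real, Real.norm_eq_abs]
      exact mul_le_mul_of_nonneg_right (hword _ _) (norm_nonneg _)
    have hBt : ∑ j, (∑ r, ∑ i, ‖P r t i j‖) ^ 2 ≤ B := by
      have := Finset.single_le_sum (f := fun t => ∑ j, (∑ r, ∑ i, ‖P r t i j‖) ^ 2)
        (fun _ _ => by positivity) (Finset.mem_univ t)
      linarith
    have huse : ∀ k : Fin n,
        ∑ j, ‖(∑ r, ∑ i, ((word (w r i) k : ℝ) : ℂ) • P r t i) j‖ ^ 2 ≤ ρ := fun k => by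
      calc _ ≤ ∑ j, (s * K) ^ 2 * (∑ r, ∑ i, ‖P r t i j‖) ^ 2 :=
            Finset.sum_le_sum fun j _ => by
              rw [← mul_pow]
              exact pow_le_pow_left₀ (norm_nonneg _) (hcoord k j) 2
        _ = (s * K) ^ 2 * ∑ j, (∑ r, ∑ i, ‖P r t i j‖) ^ 2 := by rw [Finset.mul_sum]
        _ ≤ (s * K) ^ 2 * B := by gcongr
        _ ≤ ρ := hρ
    refine (Finset.sum_le_sum fun k _ => huse k).trans ?_
    simp
  · funext t i
    refine Eq.trans (congrArg dec (funext fun k => ?_))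
      (hdec (w r t i) (fun k => l r t i (z r k)) (hz r t i))
    simp only [Code.received, map_add]
    rw [hl r t i fun r' t' i' => word (w r' t' i') k]

theorem tendsto_measure_le_abs {α : Type*} [MeasurableSpace α] (μ : Measure α) [IsFiniteMeasure μ]
    {f : α → ℝ} (hf : Measurable f) :
    Tendsto (fun s : ℝ => μ {x | s ≤ |f x|}) atTop (𝓝 0) := by
  have h := tendsto_measure_iInter_atTop (μ := μ) (s := fun s : ℝ => {x | s ≤ |f x|})
    (fun s => (measurableSet_le measurable_const hf.abs).nullMeasurableSet)
    (fun s s' hss x hx => le_trans hss hx) ⟨0, measure_ne_top _ _⟩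
  have he : ⋂ s : ℝ, {x | s ≤ |f x|} = ∅ := by
    ext x
    simp only [Set.mem_iInter, Set.mem_ofPred_eq, Set.mem_empty_iff_false, iff_false, not_forall,
      not_le]
    exact ⟨|f x| + 1, by linarith⟩
  rwa [he, measure_empty] at h

/-- The code loses one bit per use to `2 ^ n` and, since `2 / m ≤ δ / 2`, at most the fraction `δ /
2` of the bits to `K ^ (2 * (n / m))`. There remain `(1 - δ / 2) * log₂ K - 1` bits per use;
rounding `K` down costs one more bit, and `δ * log₂ ρ ≥ 8` absorbs both. -/
theorem two_rpow_le_of_pow_le {n m K size : ℕ} {δ ρ : ℝ} (hδ0 : 0 < δ) (hδ1 : δ < 1)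
    (hm : 4 ≤ δ * m) (hρ : 1 ≤ ρ) (hlog : 8 ≤ δ * Real.logb 2 ρ) (hK1 : 1 ≤ K)
    (hK : ρ ^ (1 / 2 - δ / 2) / 2 ≤ K)
    (hsize : K ^ n ≤ size * (2 ^ n * K ^ (2 * (n / m)))) :
    (2 : ℝ) ^ ((n : ℝ) * ((1 / 2 - δ) * Real.logb 2 ρ)) ≤ size := by
  have hρ0 : 0 < ρ := zero_lt_one.trans_le hρ
  have hK0 : (0 : ℝ) < K := by exact_mod_cast hK1
  have hs0 : 0 < size := by
    by_contra h
    have h0 : size = 0 := by omega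
    rw [h0, zero_mul] at hsize
    have := Nat.pow_pos (n := n) hK1
    omega
  have hs0' : (0 : ℝ) < size := by exact_mod_cast hs0
  rw [← Real.le_logb_iff_rpow_le one_lt_two hs0']
  set L := Real.logb 2 ρ
  set κ := Real.logb 2 K with hκ
  have hκ0 : 0 ≤ κ := Real.logb_nonneg one_lt_two (by exact_mod_cast hK1)
  have hκL : (1 / 2 - δ / 2) * L - 1 ≤ κ := by
    have h := Real.logb_le_logb_of_le one_lt_two (by positivity) hK
    rwa [Real.logb_div (by positivity) two_ne_zero, Real.logb_rpow_eq_mul_logb_of_pos hρ0,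
      Real.logb_self_eq_one one_lt_two] at h
  have h1 : n * κ ≤ Real.logb 2 size + (n + (2 * (n / m) : ℕ) * κ) := by
    have h : (K : ℝ) ^ n ≤ size * (2 ^ n * K ^ (2 * (n / m))) := by exact_mod_cast hsize
    have h2 := Real.logb_le_logb_of_le one_lt_two (by positivity) h
    rwa [Real.logb_mul hs0'.ne' (by positivity), Real.logb_mul (by positivity) (by positivity),
      Real.logb_pow, Real.logb_pow, Real.logb_pow, Real.logb_self_eq_one one_lt_two, mul_one] at h2
  have hm0 : (0 : ℝ) < m := by
    by_contra h
    nlinarith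
  have he : ((2 * (n / m) : ℕ) : ℝ) ≤ n * (δ / 2) := by
    have h : ((n / m : ℕ) : ℝ) * m ≤ n := by exact_mod_cast Nat.div_mul_le_self n m
    have h' : ((n / m : ℕ) : ℝ) * 4 ≤ ((n / m : ℕ) : ℝ) * (δ * m) := by gcongr
    push_cast
    nlinarith
  have h2 : ((2 * (n / m) : ℕ) : ℝ) * κ ≤ n * (δ / 2) * κ := by gcongr
  have h3 : (1 / 2 - δ) * L ≤ (1 - δ / 2) * κ - 1 := by
    have h4 : (1 - δ / 2) * ((1 / 2 - δ / 2) * L - 1) ≤ (1 - δ / 2) * κ :=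
      mul_le_mul_of_nonneg_left hκL (by linarith)
    have hL : 0 ≤ δ ^ 2 * L := by nlinarith
    nlinarith
  have h5 : n * ((1 / 2 - δ) * L) ≤ n * ((1 - δ / 2) * κ - 1) := by gcongr
  nlinarith

theorem Code.errorProb_le {M N : Fin 2 → ℕ} {Q : Fin 2 → Fin 2 → ℕ} {n : ℕ} (c : Code M N Q n)
    (H : Channel M N) {η : ℝ} (hη : 0 ≤ η)
    (h : ∀ w, (noiseLaw N n).real {z | ∃ r, c.dec r (c.received H w z r) ≠ w r} ≤ η) :
    c.errorProb H ≤ η := by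
  refine div_le_of_le_mul₀ (by positivity) hη ((Finset.sum_le_sum fun w _ => h w).trans_eq ?_)
  simp [mul_comm]

open Classical in
/-- With high probability, few noise samples are large in every one of finitely many senses. -/
theorem noiseLaw_exists_lt_card_le {N : Fin 2 → ℕ} {Q : Fin 2 → Fin 2 → ℕ} {n m : ℕ} (hm : 0 < m)
    (A : ∀ r t, Fin (Q r t) → Set (Fin (N r) → ℂ))
    (hA : ∀ r t i, (Measure.pi fun _ : Fin (N r) => complexGaussian 1) (A r t i) ≤
      ENNReal.ofReal ((1 / 4) ^ m)) :
    noiseLaw N n {z | ∃ r t i,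
      n / m < (Finset.univ.filter fun k => z r k ∈ A r t i).card} ≤
      ENNReal.ofReal ((∑ r, ∑ t, (Q r t : ℝ)) * (1 / 2) ^ n) := by
  have hterm : ∀ r t i, noiseLaw N n {z | n / m <
      (Finset.univ.filter fun k => z r k ∈ A r t i).card} ≤ ENNReal.ofReal ((1 / 2) ^ n) := by
    intro r t i
    refine (noiseLaw_setOf_lt_card_le N n (n / m) r (A r t i)).trans ?_
    refine (mul_le_mul' le_rfl (pow_le_pow_left' (hA r t i) (n / m + 1))).trans ?_
    rw [← ENNReal.ofReal_pow (by positivity), ← ENNReal.ofReal_ofNat,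
      ← ENNReal.ofReal_pow (by positivity), ← ENNReal.ofReal_mul (by positivity)]
    refine ENNReal.ofReal_le_ofReal ?_
    calc (2 : ℝ) ^ n * ((1 / 4) ^ m) ^ (n / m + 1) ≤ 2 ^ n * (1 / 4) ^ n := by
          rw [← pow_mul]
          -- More than `n / m` bad times of probability at most `(1 / 4) ^ m` each contribute at
          -- most `(1 / 4) ^ n`, which beats the `2 ^ n` choices of these times.
          have hle : n ≤ m * (n / m + 1) := (Nat.lt_mul_div_succ n hm).le
          exact mul_le_mul_of_nonneg_left
            (pow_le_pow_of_le_one (by norm_num) (by norm_num) hle) (by positivity)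
      _ = (1 / 2) ^ n := by rw [← mul_pow]; norm_num
  have hsum : ENNReal.ofReal ((∑ r, ∑ t, (Q r t : ℝ)) * (1 / 2) ^ n) =
      ∑ r, ∑ t, ∑ _i : Fin (Q r t), ENNReal.ofReal ((1 / 2) ^ n) := by
    simp only [Finset.sum_const, Finset.card_univ, Fintype.card_fin, nsmul_eq_mul,
      ← Finset.sum_mul]
    rw [ENNReal.ofReal_mul (by positivity)]
    congr 1
    have : (∑ r, ∑ t, (Q r t : ℝ)) = ((∑ r, ∑ t, Q r t : ℕ) : ℝ) := by push_cast; rfl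
    rw [this, ENNReal.ofReal_natCast]
    push_cast
    rfl
  have hset : {z : ∀ r : Fin 2, Fin n → Fin (N r) → ℂ | ∃ r t i,
      n / m < (Finset.univ.filter fun k => z r k ∈ A r t i).card} =
      ⋃ r, ⋃ t, ⋃ i, {z | n / m < (Finset.univ.filter fun k => z r k ∈ A r t i).card} := by
    ext z
    simp only [Set.mem_iUnion, Set.mem_ofPred_eq]
  rw [hsum, hset]
  refine (measure_iUnion_fintype_le _ _).trans ?_
  refine Finset.sum_le_sum fun r _ => (measure_iUnion_fintype_le _ _).trans ?_
  refine Finset.sum_le_sum fun t _ => (measure_iUnion_fintype_le _ _).trans ?_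
  exact Finset.sum_le_sum fun i _ => hterm r t i

/-- At high power every symbol can be sent at a rate close to `(1 / 2) * log₂ ρ`. -/
theorem IsAlignmentScheme.eventually_ratesAchievable {M N : Fin 2 → ℕ} {Q : Fin 2 → Fin 2 → ℕ}
    {H : Channel M N} {P : Precoders M Q} {a : Fin 2 → ℕ} (h : IsAlignmentScheme H P a) {δ : ℝ}
    (hδ0 : 0 < δ) (hδ1 : δ < 1) :
    ∀ᶠ ρ in atTop, RatesAchievable H (fun _ => {c : Code M N Q _ | c.UsesPrecoders P}) ρ
      fun _ _ _ => (1 / 2 - δ) * Real.logb 2 ρ := by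
  obtain ⟨B, hB, l, hcode⟩ := h.exists_code
  -- The code will correct a fraction `1 / m` of the positions. Both `m` and the target `(1 / 4) ^
  -- m` depend on `δ` alone, so high power reaches them.
  obtain ⟨m, hm⟩ := exists_nat_ge (4 / δ)
  rw [div_le_iff₀' hδ0] at hm
  -- Half of the level spacing. It grows with the power, and with `⌊ρ ^ (1 / 2 - δ / 2)⌋₊` levels
  -- the amplitude still stays below `√(ρ / B)`.
  have hs : Tendsto (fun ρ : ℝ => 1 / √B * ρ ^ (δ / 2) / 2) atTop atTop :=
    ((tendsto_rpow_atTop (by positivity)).const_mul_atTop (by positivity)).atTop_div_const two_pos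
  have hnoise : ∀ᶠ ρ : ℝ in atTop, ∀ r t i, (Measure.pi fun _ : Fin (N r) => complexGaussian 1)
      {x | 1 / √B * ρ ^ (δ / 2) / 2 ≤ |l r t i x|} ≤ ENNReal.ofReal ((1 / 4) ^ m) := by
    simp only [eventually_all]
    intro r t i
    exact ((tendsto_measure_le_abs _ (l r t i).continuous_of_finiteDimensional.measurable).comp
      hs).eventually_le_const (by positivity)
  have hlog : ∀ᶠ ρ : ℝ in atTop, 8 ≤ δ * Real.logb 2 ρ :=
    ((Real.tendsto_logb_atTop one_lt_two).const_mul_atTop hδ0).eventually_ge_atTop 8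
  filter_upwards [hnoise, hlog, eventually_ge_atTop 1] with ρ hp hlog hρ ε hε
  have hρ0 : 0 < ρ := zero_lt_one.trans_le hρ
  set T : ℝ := ∑ r, ∑ t, (Q r t : ℝ) with hT
  have hT0 : 0 ≤ T := Finset.sum_nonneg fun _ _ => Finset.sum_nonneg fun _ _ => Nat.cast_nonneg _
  have hlim : Tendsto (fun n : ℕ => T * (1 / 2) ^ n) atTop (𝓝 (T * 0)) :=
    (tendsto_pow_atTop_nhds_zero_of_lt_one (by norm_num) (by norm_num)).const_mul T
  rw [mul_zero] at hlim
  obtain ⟨n₀, hn₀⟩ := eventually_atTop.1 (hlim.eventually_le_const hε)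
  refine ⟨n₀, fun n hn => ?_⟩
  set x := ρ ^ (1 / 2 - δ / 2) with hx
  have hx1 : 1 ≤ x := Real.one_le_rpow hρ (by linarith)
  have hK1 : 1 ≤ ⌊x⌋₊ := (Nat.one_le_floor_iff _).2 hx1
  have hKx : (⌊x⌋₊ : ℝ) ≤ x := Nat.floor_le (by linarith)
  have hKx' : x / 2 ≤ ⌊x⌋₊ := by
    have h1 := Nat.lt_floor_add_one x
    have h2 : (1 : ℝ) ≤ ⌊x⌋₊ := by exact_mod_cast hK1
    linarith
  set s := 1 / √B * ρ ^ (δ / 2) with hsdef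
  have hs0 : 0 < s := by positivity
  have hpow : (s * ⌊x⌋₊) ^ 2 * B ≤ ρ := by
    calc (s * ⌊x⌋₊) ^ 2 * B ≤ (s * x) ^ 2 * B := by gcongr
      _ = (ρ ^ (δ / 2) * ρ ^ (1 / 2 - δ / 2)) ^ 2 := by
          rw [hsdef, ← hx]
          have hB2 : √B ^ 2 = B := Real.sq_sqrt hB.le
          field_simp
          rw [hB2]
      _ = ρ := by
          rw [← Real.rpow_add hρ0, ← Real.rpow_natCast, ← Real.rpow_mul hρ0.le]
          norm_num
  obtain ⟨c, hcP, hcpow, hcsize, hcdec⟩ := hcode n ⌊x⌋₊ (n / m) s ρ hK1 hs0 hpow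
  refine ⟨c, hcP, hcpow, fun r t i =>
    two_rpow_le_of_pow_le hδ0 hδ1 hm hρ hlog hK1 hKx' (hcsize r t i), ?_⟩
  have hm0 : 0 < m := by
    by_contra h0
    have h1 : m = 0 := by omega
    rw [h1] at hm
    norm_num at hm
  classical
  refine (c.errorProb_le H (mul_nonneg hT0 (by positivity)) fun w => ?_).trans (hn₀ n hn)
  refine ENNReal.toReal_le_of_le_ofReal (mul_nonneg hT0 (by positivity))
    ((measure_mono fun z hz => ?_).trans
      (noiseLaw_exists_lt_card_le hm0 (fun r t i => {x | s / 2 ≤ |l r t i x|}) hp))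
  by_contra hcon
  obtain ⟨r, hr⟩ := hz
  refine hr (hcdec w z (fun r t i => ?_) r)
  by_contra hlt
  exact hcon ⟨r, t, i, (not_le.1 hlt).trans_le (Finset.card_le_card fun k hk =>
    Finset.mem_filter.2 ⟨Finset.mem_univ _, (Finset.mem_filter.1 hk).2⟩)⟩

theorem RatesAchievable.mono {M N : Fin 2 → ℕ} {Q : Fin 2 → Fin 2 → ℕ} {H : Channel M N}
    {C : ∀ n, Set (Code M N Q n)} {ρ : ℝ} {R R' : ∀ r t : Fin 2, Fin (Q r t) → ℝ}
    (h : RatesAchievable H C ρ R) (hR : ∀ r t i, R' r t i ≤ R r t i) :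
    RatesAchievable H C ρ R' := by
  intro ε hε
  obtain ⟨n₀, hn₀⟩ := h ε hε
  refine ⟨n₀, fun n hn => ?_⟩
  obtain ⟨c, hc, hP, hrate, herr⟩ := hn₀ n hn
  refine ⟨c, hc, hP, fun r t i => le_trans ?_ (hrate r t i), herr⟩
  exact Real.rpow_le_rpow_of_exponent_le one_le_two
    (mul_le_mul_of_nonneg_left (hR r t i) (Nat.cast_nonneg n))

/-- One-message codes that send nothing never err; they serve at powers for which no positive rate
is known. -/
theorem ratesAchievable_zero {M N : Fin 2 → ℕ} {Q : Fin 2 → Fin 2 → ℕ} (H : Channel M N)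
    (P : Precoders M Q) {ρ : ℝ} (hρ : 0 ≤ ρ) :
    RatesAchievable H (fun _ => {c : Code M N Q _ | c.UsesPrecoders P}) ρ fun _ _ _ => 0 := by
  intro ε hε
  refine ⟨0, fun n _ => ⟨{ size := fun _ _ _ => 1
                           enc := fun _ _ => 0
                           dec := fun _ _ _ _ => 0
                           measurable_dec := fun _ => measurable_const }, ?_, ?_, ?_, ?_⟩⟩
  · exact ⟨fun _ _ _ _ _ => 0, fun t w k => by simp⟩
  · intro t w
    simp
    positivity
  · intro r t i
    simp
  · refine le_trans (Code.errorProb_le _ H le_rfl fun w => ?_) hε.le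
    have : {z | ∃ r, (fun _ _ => 0 : ∀ t : Fin 2, ∀ _ : Fin (Q r t), Fin 1) ≠ w r} =
        (∅ : Set (∀ r : Fin 2, Fin n → Fin (N r) → ℂ)) := by
      ext z
      simp only [Set.mem_ofPred_eq, Set.mem_empty_iff_false, iff_false, not_exists, not_not]
      intro r
      funext t i
      exact Subsingleton.elim (α := Fin 1) _ _
    rw [this, measureReal_empty]

/-- Each symbol of an alignment scheme has half a degree of freedom. -/
theorem IsAlignmentScheme.doFAchievable {M N : Fin 2 → ℕ} {Q : Fin 2 → Fin 2 → ℕ}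
    {H : Channel M N} {P : Precoders M Q} {a : Fin 2 → ℕ} (h : IsAlignmentScheme H P a) :
    DoFAchievable H (fun _ => {c | c.UsesPrecoders P}) fun _ _ _ => 1 / 2 := by
  classical
  set A : ℝ → ℝ → Prop := fun ρ R =>
    RatesAchievable H (fun _ => {c : Code M N Q _ | c.UsesPrecoders P}) ρ fun _ _ _ => R with hA
  -- One rate function must approach `1 / 2`, while each loss `δ` is attained only beyond its own
  -- threshold. Diagonal choice: at power `ρ` take the largest admissible `j ≤ ρ`, with `δ = 1 / (j
  -- + 2)`.
  set p : ℝ → ℕ → Prop := fun ρ j => A ρ ((1 / 2 - 1 / ((j : ℝ) + 2)) * Real.logb 2 ρ) with hp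
  set g : ℝ → ℕ := fun ρ => Nat.findGreatest (p ρ) ⌊ρ⌋₊ with hg
  have hgtop : Tendsto g atTop atTop := by
    refine tendsto_atTop.2 fun j => ?_
    have h1 := h.eventually_ratesAchievable (δ := 1 / ((j : ℝ) + 2)) (by positivity) (by
      rw [div_lt_one (by positivity)]
      have := Nat.cast_nonneg (α := ℝ) j
      linarith)
    filter_upwards [h1, eventually_ge_atTop (j : ℝ)] with ρ h2 h3
    exact Nat.le_findGreatest (Nat.le_floor h3) h2
  refine ⟨fun ρ _ _ _ => (1 / 2 - 1 / ((g ρ : ℝ) + 2)) * Real.logb 2 ρ, fun ρ hρ => ?_,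
    fun r t i => ?_⟩
  · have h0 : A ρ 0 := ratesAchievable_zero H P hρ.le
    -- The value `0` is also the default of `Nat.findGreatest`, so it certifies nothing; but `j = 0`
    -- asks only for rate `0`.
    by_cases hgz : g ρ = 0
    · refine RatesAchievable.mono h0 fun _ _ _ => ?_
      simp only [hgz]
      norm_num
    · exact Nat.findGreatest_of_ne_zero (P := p ρ) rfl hgz
  · have h1 : Tendsto (fun ρ => 1 / 2 - 1 / ((g ρ : ℝ) + 2)) atTop (𝓝 (1 / 2 - 0)) := by
      refine tendsto_const_nhds.sub (Tendsto.const_div_atTop ?_ 1)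
      exact tendsto_atTop_add_const_right _ _ (tendsto_natCast_atTop_atTop.comp hgtop)
    rw [sub_zero] at h1
    refine h1.congr' ?_
    filter_upwards [eventually_gt_atTop 1] with ρ hρ
    rw [mul_div_cancel_right₀ _ (Real.logb_pos one_lt_two hρ).ne']

/-! ### Generic channels -/

/-- The restriction of `f` to every line is a polynomial function. -/
def IsLinePolynomial {E : Type*} [AddCommGroup E] [Module ℂ E] (f : E → ℂ) : Prop :=
  ∀ x y, ∃ p : Polynomial ℂ, ∀ t : ℂ, f (x + t • y) = p.eval t

theorem IsLinePolynomial.comp {E F : Type*} [AddCommGroup E] [Module ℂ E] [AddCommGroup F]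
    [Module ℂ F] {f : E → ℂ} (hf : IsLinePolynomial f) (g : F → E) (g' : F →ₗ[ℂ] E)
    (hg : ∀ x y, g (x + y) = g x + g' y) : IsLinePolynomial fun x => f (g x) := by
  intro x y
  obtain ⟨p, hp⟩ := hf (g x) (g' y)
  exact ⟨p, fun t => by simp only [hg, map_smul, hp]⟩

/-- Polynomial functions that do not vanish identically are almost nowhere zero. -/
def HasNullZeroSets {E : Type*} [AddCommGroup E] [Module ℂ E] [MeasurableSpace E]
    (μ : Measure E) : Prop :=
  ∀ f : E → ℂ, Measurable f → IsLinePolynomial f → (∃ x, f x ≠ 0) → ∀ᵐ x ∂μ, f x ≠ 0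

/-- In one variable the function is a nonzero polynomial with finitely many roots, and the Gaussian
law has no atoms. -/
theorem hasNullZeroSets_complexGaussian {v : ℝ≥0} (hv : v ≠ 0) :
    HasNullZeroSets (complexGaussian v) := by
  intro f _ hp ⟨x₀, hx₀⟩
  obtain ⟨p, hp⟩ := hp 0 1
  have hf : ∀ x, f x = p.eval x := fun x => by simpa using hp x
  have hp0 : p ≠ 0 := by
    rintro rfl
    simp [hf] at hx₀
  have hsingle : ∀ x, complexGaussian v {x} = 0 := by
    intro x
    have hw : v / 2 ≠ 0 := by simpa using hv
    have := nullSingletonClass_gaussianReal (μ := 0) hw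
    rw [complexGaussian, MeasurableEquiv.map_apply]
    have hset : Complex.measurableEquivRealProd.symm ⁻¹' {x} ⊆ {x.re} ×ˢ Set.univ := by
      rintro q hq
      rw [Set.mem_preimage, Set.mem_singleton_iff] at hq
      exact ⟨by rw [← hq]; rfl, trivial⟩
    refine measure_mono_null hset ?_
    rw [Measure.prod_prod, measure_singleton, zero_mul]
  have hfin : {x | ¬f x ≠ 0}.Finite := by
    refine (p.roots.toFinset.finite_toSet).subset fun x hx => ?_
    have hx : p.eval x = 0 := by simpa [hf] using hx
    simpa [hp0] using hx
  rw [ae_iff, ← Set.biUnion_of_singleton {x | ¬f x ≠ 0}]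
  exact (measure_biUnion_null_iff hfin.countable).2 fun x _ => hsingle x

/-- Fubini: if `f (x₀, y₀) ≠ 0`, then `f (x, y₀) ≠ 0` for almost all `x`, and for each such `x` the
slice `f (x, ·)` does not vanish identically. Polynomiality along lines passes to slices. -/
theorem HasNullZeroSets.prod {E F : Type*} [AddCommGroup E] [Module ℂ E] [MeasurableSpace E]
    [AddCommGroup F] [Module ℂ F] [MeasurableSpace F] {μ : Measure E} {ν : Measure F}
    [SFinite μ] [SFinite ν] (hμ : HasNullZeroSets μ) (hν : HasNullZeroSets ν) :
    HasNullZeroSets (μ.prod ν) := by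
  intro f hm hp ⟨⟨x₀, y₀⟩, h₀⟩
  have hmeas : MeasurableSet {z | f z ≠ 0} := (hm (measurableSet_singleton 0)).compl
  rw [Measure.ae_prod_iff_ae_ae hmeas]
  have h1 := hμ (fun x => f (x, y₀)) (hm.comp (measurable_id.prodMk measurable_const))
    (hp.comp (fun x => (x, y₀)) (LinearMap.inl ℂ E F) fun x y => by simp) ⟨x₀, h₀⟩
  filter_upwards [h1] with x hx
  exact hν (fun y => f (x, y)) (hm.comp (measurable_const.prodMk measurable_id))
    (hp.comp (fun y => (x, y)) (LinearMap.inr ℂ E F) fun x y => by simp) ⟨y₀, hx⟩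

theorem HasNullZeroSets.pi {n : ℕ} {E : Fin n → Type*} [∀ i, AddCommGroup (E i)]
    [∀ i, Module ℂ (E i)] [∀ i, MeasurableSpace (E i)] {μ : ∀ i, Measure (E i)}
    [∀ i, SigmaFinite (μ i)] (h : ∀ i, HasNullZeroSets (μ i)) :
    HasNullZeroSets (Measure.pi μ) := by
  induction n with
  | zero =>
    intro f _ _ ⟨x, hx⟩
    exact ae_of_all _ fun y => by rwa [Subsingleton.elim y x]
  | succ n ih =>
    intro f hm hp ⟨x, hx⟩
    have hprod := (h 0).prod (ih (E := fun i => E (Fin.succAbove 0 i))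
      (μ := fun i => μ (Fin.succAbove 0 i)) fun i => h (Fin.succAbove 0 i))
    have hpres := measurePreserving_piFinSuccAbove μ 0
    set e := MeasurableEquiv.piFinSuccAbove E 0 with he
    have hadd : ∀ p q, e.symm (p + q) = e.symm p + e.symm q := fun p q => by
      apply e.injective
      rw [MeasurableEquiv.apply_symm_apply]
      rfl
    have hsmul : ∀ (t : ℂ) p, e.symm (t • p) = t • e.symm p := fun t p => by
      apply e.injective
      rw [MeasurableEquiv.apply_symm_apply]
      rfl
    have h1 := hprod (fun p => f (e.symm p)) (hm.comp e.symm.measurable)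
      (hp.comp e.symm { toFun := e.symm, map_add' := hadd, map_smul' := hsmul } hadd)
      ⟨e x, by rwa [MeasurableEquiv.symm_apply_apply]⟩
    have h2 := hpres.quasiMeasurePreserving.ae h1
    simpa only [MeasurableEquiv.symm_apply_apply] using h2

theorem hasNullZeroSets_channelLaw (M N : Fin 2 → ℕ) {v : ℝ≥0} (hv : v ≠ 0) :
    HasNullZeroSets (channelLaw M N v) :=
  HasNullZeroSets.pi fun _ => HasNullZeroSets.pi fun _ => HasNullZeroSets.pi fun _ =>
    HasNullZeroSets.pi fun _ => hasNullZeroSets_complexGaussian hv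

/-! ### Generic rank of linear families of maps -/

theorem isLinePolynomial_det {E : Type*} [AddCommGroup E] [Module ℂ E] {ι : Type*} [Fintype ι]
    [DecidableEq ι] (S : E →ₗ[ℂ] Matrix ι ι ℂ) : IsLinePolynomial fun x => (S x).det := by
  intro x y
  refine ⟨(Matrix.of fun i j => Polynomial.C (S x i j) + Polynomial.X * Polynomial.C (S y i j) :
    Matrix ι ι (Polynomial ℂ)).det, fun t => ?_⟩
  rw [← Polynomial.coe_evalRingHom, RingHom.map_det]
  refine congrArg Matrix.det (Matrix.ext fun i j => ?_)
  simp
  exact mul_comm _ _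

theorem ae_det_ne_zero {M N : Fin 2 → ℕ} {V : Type*} [AddCommGroup V] [Module ℂ V]
    [FiniteDimensional ℂ V] {v : ℝ≥0} (hv : v ≠ 0) (S : Channel M N →ₗ[ℂ] (V →ₗ[ℂ] V))
    {H₀ : Channel M N} (h : (S H₀).det ≠ 0) : ∀ᵐ H ∂channelLaw M N v, (S H).det ≠ 0 := by
  classical
  set b := Module.finBasis ℂ V
  set S' : Channel M N →ₗ[ℂ] Matrix (Fin (Module.finrank ℂ V)) (Fin (Module.finrank ℂ V)) ℂ :=
    (LinearMap.toMatrix b b).toLinearMap ∘ₗ S with hS'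
  have hdet : ∀ H, (S H).det = (S' H).det := fun H => (LinearMap.det_toMatrix b _).symm
  simp only [hdet] at h ⊢
  refine hasNullZeroSets_channelLaw M N hv _ ?_ (isLinePolynomial_det S') ⟨H₀, h⟩
  have hc : Continuous fun H => S' H := S'.continuous_of_finiteDimensional
  exact (Continuous.matrix_det hc).measurable

/-- With a fixed left inverse `g` of `S H₀`, the endomorphism `g ∘ₗ S H` is the identity at `H₀`,
hence invertible for almost every `H`. A right inverse does the same for surjectivity. -/
theorem ae_injective {M N : Fin 2 → ℕ} {V W : Type*} [AddCommGroup V] [Module ℂ V]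
    [FiniteDimensional ℂ V] [AddCommGroup W] [Module ℂ W] {v : ℝ≥0} (hv : v ≠ 0)
    (S : Channel M N →ₗ[ℂ] (V →ₗ[ℂ] W)) {H₀ : Channel M N}
    (h : Function.Injective (S H₀)) : ∀ᵐ H ∂channelLaw M N v, Function.Injective (S H) := by
  obtain ⟨g, hg⟩ := (S H₀).exists_leftInverse_of_injective (LinearMap.ker_eq_bot.2 h)
  filter_upwards [ae_det_ne_zero hv ((LinearMap.compRight ℂ g).comp S) (H₀ := H₀) (by
    simp [hg])] with H hH
  have hinj : Function.Injective (g ∘ₗ S H) := by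
    refine LinearMap.ker_eq_bot.1 ?_
    by_contra hne
    exact hH (LinearMap.det_eq_zero_iff_ker_ne_bot.2 hne)
  exact Function.Injective.of_comp hinj

theorem ae_surjective {M N : Fin 2 → ℕ} {V W : Type*} [AddCommGroup V] [Module ℂ V]
    [AddCommGroup W] [Module ℂ W] [FiniteDimensional ℂ W] {v : ℝ≥0} (hv : v ≠ 0)
    (S : Channel M N →ₗ[ℂ] (V →ₗ[ℂ] W)) {H₀ : Channel M N}
    (h : Function.Surjective (S H₀)) : ∀ᵐ H ∂channelLaw M N v, Function.Surjective (S H) := by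
  obtain ⟨g, hg⟩ := (S H₀).exists_rightInverse_of_surjective (LinearMap.range_eq_top.2 h)
  filter_upwards [ae_det_ne_zero hv ((LinearMap.lcomp ℂ W g).comp S) (H₀ := H₀) (by
    simp [LinearMap.lcomp_apply', hg])] with H hH
  have hsurj : Function.Surjective (S H ∘ₗ g) := by
    refine LinearMap.surjective_of_injective (LinearMap.ker_eq_bot.1 ?_)
    by_contra hne
    exact hH (LinearMap.det_eq_zero_iff_ker_ne_bot.2 hne)
  exact Function.Surjective.of_comp hsurj

/-! ### The rank conditions on the channel -/

/-- `Channel.apply` as a linear map. -/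
def Channel.lin {M N : Fin 2 → ℕ} (H : Channel M N) (r t : Fin 2) :
    (Fin (M t) → ℂ) →ₗ[ℂ] (Fin (N r) → ℂ) :=
  (Matrix.of (H r t)).mulVecLin

theorem Channel.lin_add {M N : Fin 2 → ℕ} (H H' : Channel M N) (r t : Fin 2) :
    (H + H').lin r t = H.lin r t + H'.lin r t :=
  Matrix.mulVecLin_add _ _

theorem Channel.lin_smul {M N : Fin 2 → ℕ} (c : ℂ) (H : Channel M N) (r t : Fin 2) :
    (c • H).lin r t = c • H.lin r t :=
  LinearMap.ext fun x => Matrix.smul_mulVec c (Matrix.of (H r t)) x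

/-- The joint channel from both transmitters to the receiver `r`. -/
def Channel.joint {M N : Fin 2 → ℕ} (r : Fin 2) :
    Channel M N →ₗ[ℂ] (((Fin (M 0) → ℂ) × (Fin (M 1) → ℂ)) →ₗ[ℂ] (Fin (N r) → ℂ)) where
  toFun H := (H.lin r 0).coprod (H.lin r 1)
  map_add' H H' := by
    refine LinearMap.ext fun p => ?_
    simp only [Channel.lin_add, LinearMap.coprod_apply, LinearMap.add_apply]
    abel
  map_smul' c H := by
    refine LinearMap.ext fun p => ?_
    simp [Channel.lin_smul]

/-- The map whose kernel consists of the signals of transmitter `t` that can be aligned at both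
receivers, together with their partners. -/
def Channel.doubleAlignment {M N : Fin 2 → ℕ} (t : Fin 2) :
    Channel M N →ₗ[ℂ] (((Fin (M t) → ℂ) × (Fin (M t.rev) → ℂ) × (Fin (M t.rev) → ℂ)) →ₗ[ℂ]
      (Fin (N 1) → ℂ) × (Fin (N 0) → ℂ)) where
  toFun H := LinearMap.prod
    ((H.lin 1 t).coprod (-(H.lin 1 t.rev) ∘ₗ LinearMap.fst ℂ _ _))
    ((H.lin 0 t).coprod (-(H.lin 0 t.rev) ∘ₗ LinearMap.snd ℂ _ _))
  map_add' H H' := by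
    refine LinearMap.ext fun x => ?_
    simp only [Channel.lin_add, LinearMap.prod_apply, Function.prod, LinearMap.coprod_apply,
      LinearMap.add_apply, LinearMap.neg_apply, LinearMap.comp_apply, Prod.mk_add_mk, neg_add]
    refine Prod.ext ?_ ?_ <;> simp only <;> abel
  map_smul' c H := by
    refine LinearMap.ext fun x => ?_
    simp [Channel.lin_smul, Function.prod]

theorem sum_ite_eq_add_mul {m : ℕ} (c i : ℕ) (x : Fin m → ℂ) :
    ∑ j : Fin m, (if i = c + (j : ℕ) then (1 : ℂ) else 0) * x j =
      if h : c ≤ i ∧ i - c < m then x ⟨i - c, h.2⟩ else 0 := by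
  split_ifs with h
  · rw [Finset.sum_eq_single ⟨i - c, h.2⟩]
    · have : i = c + (i - c) := by omega
      simp [← this]
    · intro j _ hj
      have : i ≠ c + (j : ℕ) := fun h' => hj (Fin.ext (by simp; omega))
      simp [this]
    · simp
  · refine Finset.sum_eq_zero fun j _ => ?_
    have : i ≠ c + (j : ℕ) := fun h' => h ⟨by omega, by omega⟩
    simp [this]

/-- The rank conditions that the alignment schemes need. -/
structure Channel.IsGeneric {M N : Fin 2 → ℕ} (H : Channel M N) : Prop where
  injective : ∀ r, M 0 + M 1 ≤ N r → Function.Injective (Channel.joint r H)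
  surjective : ∀ r, N r ≤ M 0 + M 1 → Function.Surjective (Channel.joint r H)
  doubleAlignment : ∀ t, Function.Injective (Channel.doubleAlignment t H)

theorem ae_joint {M N : Fin 2 → ℕ} {v : ℝ≥0} (hv : v ≠ 0) (r : Fin 2) :
    ∀ᵐ H ∂channelLaw M N v, (M 0 + M 1 ≤ N r → Function.Injective (Channel.joint r H)) ∧
      (N r ≤ M 0 + M 1 → Function.Surjective (Channel.joint r H)) := by
  -- The antennas of both transmitters are wired to consecutive receive antennas, so the joint
  -- channel is a rectangular identity matrix.
  set H₀ : Channel M N := fun _ s i j =>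
    if (i : ℕ) = (if s = 0 then 0 else M 0) + (j : ℕ) then 1 else 0 with hH₀
  have hval : ∀ (p : (Fin (M 0) → ℂ) × (Fin (M 1) → ℂ)) (i : Fin (N r)),
      Channel.joint r H₀ p i = (if h : (i : ℕ) < M 0 then p.1 ⟨i, h⟩ else 0) +
        if h : M 0 ≤ i ∧ (i : ℕ) - M 0 < M 1 then p.2 ⟨i - M 0, h.2⟩ else 0 := by
    intro p i
    have h1 := sum_ite_eq_add_mul 0 i p.1
    have h2 := sum_ite_eq_add_mul (M 0) i p.2
    simp only [Nat.zero_le, true_and, Nat.sub_zero] at h1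
    rw [← h1, ← h2]
    simp [Channel.joint, Channel.lin, hH₀, Matrix.mulVec, dotProduct]
  have hinj : ∀ᵐ H ∂channelLaw M N v, M 0 + M 1 ≤ N r → Function.Injective (Channel.joint r H) := by
    by_cases hle : M 0 + M 1 ≤ N r
    · refine (ae_injective hv (Channel.joint r) (H₀ := H₀) ?_).mono fun _ h _ => h
      rw [← LinearMap.ker_eq_bot, LinearMap.ker_eq_bot']
      intro p hp
      have hz : ∀ i, Channel.joint r H₀ p i = 0 := fun i => congrFun hp i
      refine Prod.ext (funext fun j => ?_) (funext fun j => ?_)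
      · have h := hz ⟨j, by omega⟩
        have hj : ¬M 0 ≤ (j : ℕ) := by omega
        rw [hval] at h
        simpa [hj] using h
      · have h := hz ⟨M 0 + j, by omega⟩
        rw [hval] at h
        simpa using h
    · exact ae_of_all _ fun _ h => absurd h hle
  have hsurj : ∀ᵐ H ∂channelLaw M N v, N r ≤ M 0 + M 1 →
      Function.Surjective (Channel.joint r H) := by
    by_cases hle : N r ≤ M 0 + M 1
    · refine (ae_surjective hv (Channel.joint r) (H₀ := H₀) ?_).mono fun _ h _ => h
      intro w
      refine ⟨(fun j => if h : (j : ℕ) < N r then w ⟨j, h⟩ else 0,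
        fun j => if h : M 0 + (j : ℕ) < N r then w ⟨M 0 + j, h⟩ else 0), funext fun i => ?_⟩
      rw [hval]
      by_cases hi : (i : ℕ) < M 0
      · have h2 : ¬M 0 ≤ (i : ℕ) := by omega
        simp [hi, h2]
      · have h2 : M 0 ≤ (i : ℕ) := by omega
        have h3 : (i : ℕ) - M 0 < M 1 := by omega
        have h4 : M 0 + ((i : ℕ) - M 0) = i := by omega
        simp [hi, h2, h3, h4]
    · exact ae_of_all _ fun _ h => absurd h hle
  filter_upwards [hinj, hsurj] with H h1 h2 using ⟨h1, h2⟩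

theorem ae_doubleAlignment {M N : Fin 2 → ℕ} {v : ℝ≥0} (hv : v ≠ 0) (t : Fin 2)
    (h0 : M t.rev ≤ N 0) (h1 : M t.rev ≤ N 1) (hsum : 2 * M t.rev + M t ≤ N 0 + N 1) :
    ∀ᵐ H ∂channelLaw M N v, Function.Injective (Channel.doubleAlignment t H) := by
  -- Transmitter `t.rev` occupies the first `M t.rev` antennas of both receivers. Transmitter `t` is
  -- wired to the antennas after these: its first `N 1 - M t.rev` antennas at receiver `1`, the
  -- others at receiver `0`. There is room for all of them by `hsum`.
  set H₀ : Channel M N := fun r s i j =>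
    if (i : ℕ) + (if s = t ∧ r = 0 then N 1 - M t.rev else 0) =
      (if s = t then M t.rev else 0) + (j : ℕ) then 1 else 0 with hH₀
  have hne : t.rev ≠ t := by fin_cases t <;> decide
  have hrev : ∀ r (y : Fin (M t.rev) → ℂ) (i : Fin (N r)),
      H₀.lin r t.rev y i = if h : (i : ℕ) < M t.rev then y ⟨i, h⟩ else 0 := by
    intro r y i
    have h := sum_ite_eq_add_mul 0 i y
    simp only [Nat.zero_le, true_and, Nat.sub_zero] at h
    rw [← h]
    simp [Channel.lin, hH₀, Matrix.mulVec, dotProduct, hne]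
  have hx1 : ∀ (x : Fin (M t) → ℂ) (i : Fin (N 1)), H₀.lin 1 t x i =
      if h : M t.rev ≤ i ∧ (i : ℕ) - M t.rev < M t then x ⟨i - M t.rev, h.2⟩ else 0 := by
    intro x i
    rw [← sum_ite_eq_add_mul (M t.rev) i x]
    simp [Channel.lin, hH₀, Matrix.mulVec, dotProduct]
  have hx0 : ∀ (x : Fin (M t) → ℂ) (i : Fin (N 0)), H₀.lin 0 t x i =
      if h : M t.rev ≤ i + (N 1 - M t.rev) ∧ (i : ℕ) + (N 1 - M t.rev) - M t.rev < M t then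
        x ⟨i + (N 1 - M t.rev) - M t.rev, h.2⟩ else 0 := by
    intro x i
    rw [← sum_ite_eq_add_mul (M t.rev) (i + (N 1 - M t.rev)) x]
    simp [Channel.lin, hH₀, Matrix.mulVec, dotProduct]
  refine ae_injective hv (Channel.doubleAlignment t) (H₀ := H₀) ?_
  rw [← LinearMap.ker_eq_bot, LinearMap.ker_eq_bot']
  rintro ⟨x, y, y'⟩ hp
  have hp1 : ∀ i, H₀.lin 1 t x i = H₀.lin 1 t.rev y i := fun i => by
    have := congrFun (congrArg Prod.fst hp) i
    simpa [Channel.doubleAlignment, ← sub_eq_add_neg, sub_eq_zero] using this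
  have hp0 : ∀ i, H₀.lin 0 t x i = H₀.lin 0 t.rev y' i := fun i => by
    have := congrFun (congrArg Prod.snd hp) i
    simpa [Channel.doubleAlignment, ← sub_eq_add_neg, sub_eq_zero] using this
  have hx : x = 0 := by
    funext j
    -- Each antenna of `t` is seen at one of the receivers on a coordinate that `t.rev` does not
    -- reach, so alignment there forces its entry to vanish.
    by_cases hj : M t.rev + (j : ℕ) < N 1
    · have h := hp1 ⟨M t.rev + j, hj⟩
      rw [hx1, hrev] at h
      simpa using h
    · have hlt : M t.rev + (j : ℕ) - (N 1 - M t.rev) < N 0 := by omega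
      have h := hp0 ⟨M t.rev + (j : ℕ) - (N 1 - M t.rev), hlt⟩
      have e : M t.rev + (j : ℕ) - (N 1 - M t.rev) + (N 1 - M t.rev) = M t.rev + j := by omega
      have hge : ¬M t.rev + (j : ℕ) - (N 1 - M t.rev) < M t.rev := by omega
      rw [hx0, hrev] at h
      simpa [e, hge] using h
  subst hx
  have hy : ∀ r (y : Fin (M t.rev) → ℂ), M t.rev ≤ N r → (∀ i, 0 = H₀.lin r t.rev y i) → y = 0 := by
    intro r y hle h
    funext j
    have := h ⟨j, by omega⟩
    rw [hrev] at this
    simpa using this.symm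
  rw [hy 1 y h1 fun i => by rw [← hp1]; simp, hy 0 y' h0 fun i => by rw [← hp0]; simp]
  rfl

theorem ae_isGeneric {M N : Fin 2 → ℕ} {v : ℝ≥0} (hv : v ≠ 0) (hMN : ∀ r t, M t ≤ N r)
    (hsum : ∀ t, 2 * M t.rev + M t ≤ N 0 + N 1) :
    ∀ᵐ H ∂channelLaw M N v, H.IsGeneric := by
  have h1 : ∀ᵐ H ∂channelLaw M N v, ∀ r, _ := ae_all_iff.2 fun r => ae_joint (M := M) (N := N) hv r
  have h2 : ∀ᵐ H ∂channelLaw M N v, ∀ t, _ := ae_all_iff.2 fun t =>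
    ae_doubleAlignment (M := M) (N := N) hv t (hMN 0 _) (hMN 1 _) (hsum t)
  filter_upwards [h1, h2] with H h1 h2
  exact ⟨fun r => (h1 r).1, fun r => (h1 r).2, h2⟩

/-! ### Existence of alignment schemes -/

theorem LinearIndependent.of_forall_eq {V ι : Type*} [AddCommGroup V] [Module ℝ V] {v v' : ι → V}
    (h : LinearIndependent ℝ v) (he : ∀ i, v i = v' i) : LinearIndependent ℝ v' :=
  (funext he : v = v') ▸ h

-- As long as the family has fewer members than the dimension, its span is proper, and any vector
-- outside can be added.
open Module in
theorem LinearIndependent.exists_extend_fin {V ι : Type*} [AddCommGroup V] [Module ℝ V]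
    [FiniteDimensional ℝ V] [Fintype ι] {v : ι → V} (hv : LinearIndependent ℝ v) (n : ℕ)
    (h : Fintype.card ι + n ≤ finrank ℝ V) :
    ∃ w : Fin n → V, LinearIndependent ℝ (Sum.elim v w) := by
  induction n with
  | zero =>
    refine ⟨Fin.elim0, hv.sum_type (v' := (Fin.elim0 : Fin 0 → V)) linearIndependent_empty_type ?_⟩
    rw [Set.range_eq_empty (Fin.elim0 : Fin 0 → V), Submodule.span_empty]
    exact disjoint_bot_right
  | succ n ih =>
    obtain ⟨w, hw⟩ := ih (by omega)
    have hne : Submodule.span ℝ (Set.range (Sum.elim v w)) < ⊤ := by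
      refine lt_top_iff_ne_top.2 fun htop => ?_
      have h1 := finrank_span_eq_card hw
      rw [htop, finrank_top, Fintype.card_sum, Fintype.card_fin] at h1
      omega
    obtain ⟨x, -, hx⟩ := SetLike.exists_of_lt hne
    have h2 := (hw.option hx).comp
      (Sum.elim (fun i => some (Sum.inl i))
        (Fin.cases none fun i => some (Sum.inr i)) : ι ⊕ Fin (n + 1) → Option (ι ⊕ Fin n)) (by
        rintro (i | i) (j | j) hij
        · simpa using hij
        · cases j using Fin.cases <;> simp at hij
        · cases i using Fin.cases <;> simp at hij
        · cases i using Fin.cases <;> cases j using Fin.cases <;> simp at hij ⊢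
          exact hij)
    refine ⟨Fin.cases x w, h2.of_forall_eq fun i => ?_⟩
    rcases i with i | i
    · rfl
    · cases i using Fin.cases <;> rfl

open Module in
/-- Two jointly independent families can be prolonged to given lengths. -/
theorem LinearIndependent.exists_prolongation {V : Type*} [AddCommGroup V] [Module ℝ V]
    [FiniteDimensional ℝ V] {a q : Fin 2 → ℕ} {u : ∀ r, Fin (a r) → V}
    (hu : LinearIndependent ℝ (Sum.elim (u 0) (u 1))) (haq : ∀ r, a r ≤ q r)
    (hq : q 0 + q 1 ≤ finrank ℝ V) :
    ∃ p : ∀ r, Fin (q r) → V, LinearIndependent ℝ (Sum.elim (p 0) (p 1)) ∧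
      ∀ r i, p r (Fin.castLE (haq r) i) = u r i := by
  obtain ⟨d, hd⟩ : ∃ d : Fin 2 → ℕ, ∀ r, q r = a r + d r :=
    ⟨fun r => q r - a r, fun r => by have := haq r; simp only; omega⟩
  obtain rfl : q = fun r => a r + d r := funext hd
  obtain ⟨w, hw⟩ := hu.exists_extend_fin (d 0 + d 1) (by
    simp only [Fintype.card_sum, Fintype.card_fin] at hq ⊢
    omega)
  let w' : ∀ r, Fin (d r) → V := fun r => match r with
    | 0 => fun i => w (Fin.castAdd _ i)
    | 1 => fun i => w (Fin.natAdd _ i)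
  refine ⟨fun r => Fin.append (u r) (w' r), ?_, fun r i => ?_⟩
  · have h2 := hw.comp _ ((finSumFinEquiv.symm.sumCongr finSumFinEquiv.symm).trans
      ((Equiv.sumSumSumComm _ _ _ _).trans
        ((Equiv.refl (Fin (a 0) ⊕ Fin (a 1))).sumCongr finSumFinEquiv))).injective
    refine h2.of_forall_eq fun i => ?_
    rcases i with i | i
    · cases i using Fin.addCases <;> simp [w']
    · cases i using Fin.addCases <;> simp [w']
  · exact Fin.append_left _ _ i

/-! ### Signals that can be aligned at a receiver -/

namespace Channel

variable {M N : Fin 2 → ℕ} {H : Channel M N}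

theorem IsGeneric.lin_injective (hH : H.IsGeneric) (r t : Fin 2) :
    Function.Injective (H.lin r t) := by
  have h1 : ∀ t : Fin 2, Function.Injective (H.lin 1 t.rev) := fun t => by
    rw [← LinearMap.ker_eq_bot, LinearMap.ker_eq_bot']
    intro y hy
    have h := hH.doubleAlignment t (a₁ := (0, y, 0)) (a₂ := 0) (by
      simp [Channel.doubleAlignment, hy])
    exact congrArg (fun p => p.2.1) h
  have h0 : ∀ t : Fin 2, Function.Injective (H.lin 0 t.rev) := fun t => by
    rw [← LinearMap.ker_eq_bot, LinearMap.ker_eq_bot']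
    intro y hy
    have h := hH.doubleAlignment t (a₁ := (0, 0, y)) (a₂ := 0) (by
      simp [Channel.doubleAlignment, hy])
    exact congrArg (fun p => p.2.2) h
  exact match r, t with
    | 0, 0 => h0 1
    | 0, 1 => h0 0
    | 1, 0 => h1 1
    | 1, 1 => h1 0

theorem joint_inl (H : Channel M N) (r : Fin 2) (x : Fin (M 0) → ℂ) :
    Channel.joint r H (x, 0) = H.apply r 0 x := by
  simp only [Channel.joint, LinearMap.coe_mk, AddHom.coe_mk, LinearMap.coprod_apply, map_zero,
    add_zero]
  rfl

theorem joint_inr (H : Channel M N) (r : Fin 2) (y : Fin (M 1) → ℂ) :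
    Channel.joint r H (0, y) = H.apply r 1 y := by
  simp only [Channel.joint, LinearMap.coe_mk, AddHom.coe_mk, LinearMap.coprod_apply, map_zero,
    zero_add]
  rfl

/-- The signals of transmitter `t` that can be aligned at receiver `r`, parametrized by the kernel
of the joint channel. -/
def alignedSignal (H : Channel M N) (r : Fin 2) :
    ∀ t : Fin 2, LinearMap.ker (Channel.joint r H) →ₗ[ℂ] (Fin (M t) → ℂ)
  | 0 => LinearMap.fst ℂ _ _ ∘ₗ (LinearMap.ker (Channel.joint r H)).subtype
  | 1 => -(LinearMap.snd ℂ _ _ ∘ₗ (LinearMap.ker (Channel.joint r H)).subtype)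

theorem lin_alignedSignal (r : Fin 2) (u : LinearMap.ker (Channel.joint r H)) :
    H.lin r 0 (alignedSignal H r 0 u) = H.lin r 1 (alignedSignal H r 1 u) := by
  have h : H.lin r 0 u.1.1 + H.lin r 1 u.1.2 = 0 := LinearMap.mem_ker.1 u.2
  have h0 : alignedSignal H r 0 u = u.1.1 := rfl
  have h1 : alignedSignal H r 1 u = -u.1.2 := rfl
  rw [h0, h1, map_neg]
  exact eq_neg_of_add_eq_zero_left h

theorem lin_alignedSignal_rev (r t : Fin 2) (u : LinearMap.ker (Channel.joint r H)) :
    H.lin r t (alignedSignal H r t u) = H.lin r t.rev (alignedSignal H r t.rev u) :=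
  match t with
  | 0 => lin_alignedSignal r u
  | 1 => (lin_alignedSignal r u).symm

theorem IsGeneric.alignedSignal_injective (hH : H.IsGeneric) (r t : Fin 2) :
    Function.Injective (alignedSignal H r t) := by
  rw [← LinearMap.ker_eq_bot, LinearMap.ker_eq_bot']
  intro u hu
  have hrev : alignedSignal H r t.rev u = 0 := by
    apply hH.lin_injective r t.rev
    rw [← lin_alignedSignal_rev, hu, map_zero, map_zero]
  have hboth : alignedSignal H r 0 u = 0 ∧ alignedSignal H r 1 u = 0 :=
    match t, hu, hrev with
    | 0, hu, hrev => ⟨hu, hrev⟩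
    | 1, hu, hrev => ⟨hrev, hu⟩
  refine Subtype.ext (Prod.ext hboth.1 ?_)
  exact neg_eq_zero.1 hboth.2

/-- Such a signal, with its partners at the two receivers, lies in the kernel of
`Channel.doubleAlignment`. This is what makes the aligned families for the two receivers independent
at a transmitter. -/
theorem IsGeneric.eq_zero_of_alignedSignal_eq (hH : H.IsGeneric) (t : Fin 2)
    {u : LinearMap.ker (Channel.joint 1 H)} {u' : LinearMap.ker (Channel.joint 0 H)}
    (h : alignedSignal H 1 t u = alignedSignal H 0 t u') : alignedSignal H 1 t u = 0 := by
  have h1 := hH.doubleAlignment t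
    (a₁ := (alignedSignal H 1 t u, alignedSignal H 1 t.rev u, alignedSignal H 0 t.rev u'))
    (a₂ := 0) (by
      rw [map_zero]
      refine Prod.ext ?_ ?_
      · simp [Channel.doubleAlignment, lin_alignedSignal_rev 1 t u]
      · simp [Channel.doubleAlignment, h, lin_alignedSignal_rev 0 t u'])
  exact congrArg Prod.fst h1

-- Rank-nullity with full rank; truncated subtraction gives `0` when the joint channel is injective.
open Module in
theorem IsGeneric.finrank_ker_joint (hH : H.IsGeneric) (r : Fin 2) :
    finrank ℂ (LinearMap.ker (Channel.joint r H)) = M 0 + M 1 - N r := by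
  have hrn := (Channel.joint r H).finrank_range_add_finrank_ker
  rw [finrank_prod, finrank_fin_fun, finrank_fin_fun] at hrn
  rcases le_total (M 0 + M 1) (N r) with hle | hle
  · rw [LinearMap.ker_eq_bot.2 (hH.injective r hle), finrank_bot]
    omega
  · rw [LinearMap.range_eq_top.2 (hH.surjective r hle), finrank_top, finrank_fin_fun] at hrn
    omega

end Channel

theorem card_subtype_fin_ge (q a : ℕ) : Fintype.card {i : Fin q // a ≤ (i : ℕ)} = q - a := by
  rw [Fintype.card_subtype]
  rcases le_or_gt q a with h | h
  · rw [Finset.filter_false_of_mem fun i _ => by omega]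
    simp
    omega
  · have : (Finset.univ.filter fun i : Fin q => a ≤ (i : ℕ)) = Finset.Ici ⟨a, h⟩ := by
      ext i
      simp [Fin.le_def]
    rw [this, Fin.card_Ici]

/-! ### The two constructions of alignment schemes -/

open Module in
/-- If neither receiver wastes dimensions, the transmitters can use all their dimensions. -/
theorem Channel.IsGeneric.exists_full_alignmentScheme {M N : Fin 2 → ℕ} {H : Channel M N}
    (hH : H.IsGeneric) {Q : Fin 2 → Fin 2 → ℕ}
    (ha : ∀ r t, 2 * (M 0 + M 1 - N r.rev) ≤ Q r t) (hQ : ∀ t, Q 0 t + Q 1 t = 2 * M t) :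
    ∃ P : Precoders M Q, IsAlignmentScheme H P fun r => 2 * (M 0 + M 1 - N r.rev) := by
  -- A real basis of the kernel at receiver `r`. Its components are used as precoders for the other
  -- receiver, so all possible alignments are exploited.
  have hbasis : ∀ r, ∃ b : Fin (2 * (M 0 + M 1 - N r)) → LinearMap.ker (Channel.joint r H),
      LinearIndependent ℝ b := fun r =>
    ⟨finBasisOfFinrankEq ℝ _ (by rw [finrank_real_of_complex, hH.finrank_ker_joint]),
      Basis.linearIndependent _⟩
  choose b hb using hbasis
  have hX : ∀ r t, LinearIndependent ℝ fun i => Channel.alignedSignal H r t (b r i) := fun r t =>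
    (hb r).map' ((Channel.alignedSignal H r t).restrictScalars ℝ)
      (LinearMap.ker_eq_bot.2 (hH.alignedSignal_injective r t))
  have hspan : ∀ r t, Submodule.span ℝ (Set.range fun i => Channel.alignedSignal H r t (b r i)) ≤
      LinearMap.range ((Channel.alignedSignal H r t).restrictScalars ℝ) := fun r t => by
    rw [Submodule.span_le]
    rintro _ ⟨i, rfl⟩
    exact ⟨b r i, rfl⟩
  have hpro : ∀ t, ∃ p : ∀ r, Fin (Q r t) → (Fin (M t) → ℂ),
      LinearIndependent ℝ (Sum.elim (p 0) (p 1)) ∧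
      ∀ r i, p r (Fin.castLE (ha r t) i) = Channel.alignedSignal H r.rev t (b r.rev i) := by
    intro t
    refine LinearIndependent.exists_prolongation (V := Fin (M t) → ℂ)
      (a := fun r => 2 * (M 0 + M 1 - N r.rev)) (q := fun r => Q r t)
      (u := fun r i => Channel.alignedSignal H r.rev t (b r.rev i)) ?_ (fun r => ha r t) ?_
    · refine (hX 1 t).sum_type (hX 0 t) (Submodule.disjoint_def.2 fun z hz hz' => ?_)
      obtain ⟨u, rfl⟩ := hspan 1 t hz
      obtain ⟨u', hu'⟩ := hspan 0 t hz'
      exact hH.eq_zero_of_alignedSignal_eq t hu'.symm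
    · rw [finrank_real_of_complex, finrank_fin_fun, hQ]
  choose p hp hpa using hpro
  have halign : ∀ r i, H.apply r.rev 0 (p 0 r (Fin.castLE (ha r 0) i)) =
      H.apply r.rev 1 (p 1 r (Fin.castLE (ha r 1) i)) := fun r i => by
    rw [hpa, hpa]
    exact Channel.lin_alignedSignal r.rev _
  have halign' : ∀ s r (_ : r.rev = s) (i : ℕ) (hi : i < 2 * (M 0 + M 1 - N r.rev)),
      H.apply s 0 (p 0 r ⟨i, hi.trans_le (ha r 0)⟩) =
        H.apply s 1 (p 1 r ⟨i, hi.trans_le (ha r 1)⟩) := by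
    rintro s r rfl i hi
    exact halign r ⟨i, hi⟩
  refine ⟨fun r t => p t r, ha, halign, fun r => ?_⟩
  -- The precoders of each transmitter form a real basis, so the received columns span the whole
  -- range of the joint channel. Their number is `2 * (M 0 + M 1)` minus the real dimension of the
  -- kernel, which is the dimension of that range, so they are independent.
  rw [linearIndependent_iff_card_le_finrank_span]
  set P : Precoders M Q := fun r t => p t r with hP
  set cols := receivedColumns H P (fun r => 2 * (M 0 + M 1 - N r.rev)) r with hcols
  set S := Submodule.span ℝ (Set.range cols) with hS
  have hmem0 : ∀ j, cols j ∈ S := fun j => Submodule.subset_span ⟨j, rfl⟩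
  have hown : ∀ t i, H.apply r t (p t r i) ∈ S := fun t i => hmem0 (Sum.inl ⟨t, i⟩)
  have hint0 : ∀ i, H.apply r 0 (p 0 r.rev i) ∈ S := fun i => hmem0 (Sum.inr (Sum.inl i))
  have hint1 : ∀ i, H.apply r 1 (p 1 r.rev i) ∈ S := fun i => by
    by_cases hi : 2 * (M 0 + M 1 - N r.rev.rev) ≤ i
    · exact hmem0 (Sum.inr (Sum.inr ⟨i, hi⟩))
    · exact (halign' r r.rev (Fin.rev_rev r) i (not_le.1 hi)) ▸ hint0 _
  have hall : ∀ t r' i, H.apply r t (p t r' i) ∈ S := by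
    intro t r' i
    have hint : ∀ i, H.apply r t (p t r.rev i) ∈ S :=
      match t with
      | 0 => hint0
      | 1 => hint1
    have hr : r' = r ∨ r' = r.rev := by
      clear * -
      revert r r'; decide
    rcases hr with rfl | rfl
    · exact hown t i
    · exact hint i
  have hlin : ∀ t x, H.lin r t x ∈ S := by
    intro t x
    have htop : Submodule.span ℝ (Set.range (Sum.elim (p t 0) (p t 1))) = ⊤ := by
      refine (hp t).span_eq_top_of_card_eq_finrank' ?_
      rw [Fintype.card_sum, Fintype.card_fin, Fintype.card_fin, finrank_real_of_complex,
        finrank_fin_fun, hQ]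
    have hle : Submodule.span ℝ (Set.range (Sum.elim (p t 0) (p t 1))) ≤
        S.comap ((H.lin r t).restrictScalars ℝ) := by
      rw [Submodule.span_le]
      rintro _ ⟨i | i, rfl⟩
      · exact hall t 0 i
      · exact hall t 1 i
    rw [htop] at hle
    exact hle trivial
  have hrange : LinearMap.range ((Channel.joint r H).restrictScalars ℝ) ≤ S := by
    rintro _ ⟨x, rfl⟩
    exact S.add_mem (hlin 0 x.1) (hlin 1 x.2)
  have hfin : finrank ℝ (LinearMap.range ((Channel.joint r H).restrictScalars ℝ)) =
      2 * finrank ℂ (LinearMap.range (Channel.joint r H)) :=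
    finrank_real_of_complex (LinearMap.range (Channel.joint r H))
  have hrn := (Channel.joint r H).finrank_range_add_finrank_ker
  rw [finrank_prod, finrank_fin_fun, finrank_fin_fun, hH.finrank_ker_joint] at hrn
  have hle := Submodule.finrank_mono hrange
  rw [hfin] at hle
  refine le_trans ?_ hle
  have hrr : r.rev.rev = r := Fin.rev_rev r
  have hcard : Fintype.card (((t : Fin 2) × Fin (Q r t)) ⊕ (Fin (Q r.rev 0) ⊕
      {i : Fin (Q r.rev 1) // 2 * (M 0 + M 1 - N r.rev.rev) ≤ (i : ℕ)})) =
      Q r 0 + Q r 1 + (Q r.rev 0 + (Q r.rev 1 - 2 * (M 0 + M 1 - N r))) := by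
    rw [Fintype.card_sum, Fintype.card_sum, Fintype.card_sigma, card_subtype_fin_ge, hrr]
    simp
  have hQr : ∀ t, Q r t + Q r.rev t = 2 * M t := fun t =>
    match r with
    | 0 => hQ t
    | 1 => (add_comm _ _).trans (hQ t)
  have ha' := ha r.rev 1
  rw [hrr] at ha'
  have h0 := hQr 0
  have h1 := hQr 1
  refine (le_of_eq hcard).trans ?_
  omega

open Module in
/-- If receiver `1` has as many antennas as transmitter `0`, all symbols of transmitter `1` for
receiver `0` can be aligned at receiver `1`. -/
theorem Channel.IsGeneric.exists_alignmentScheme_of_eq {M N : Fin 2 → ℕ} {H : Channel M N}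
    (hH : H.IsGeneric) (hNM : N 1 = M 0) (hN0 : M 0 + M 1 ≤ N 0) {Q : Fin 2 → Fin 2 → ℕ}
    (hQ0 : Q 0 0 = Q 0 1) (hQ1 : Q 0 1 + Q 1 1 ≤ 2 * M 1)
    (hQ2 : Q 0 1 + Q 1 1 + Q 1 0 ≤ 2 * M 0) :
    ∃ P : Precoders M Q, IsAlignmentScheme H P ![Q 0 1, 0] := by
  have hsurj : Function.Surjective (H.lin 1 0) :=
    (LinearMap.injective_iff_surjective_of_finrank_eq_finrank (by
      rw [finrank_fin_fun, finrank_fin_fun, hNM])).1 (hH.lin_injective 1 0)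
  -- Since `N 1 = M 0`, the map `H.lin 1 0` is bijective, and `T` sends each signal of transmitter
  -- `1` to the signal of transmitter `0` that looks the same at receiver `1`.
  obtain ⟨g, hg⟩ := (H.lin 1 0).exists_rightInverse_of_surjective (LinearMap.range_eq_top.2 hsurj)
  set T := g ∘ₗ H.lin 1 1 with hTdef
  have hT : ∀ y, H.lin 1 0 (T y) = H.lin 1 1 y := fun y => LinearMap.congr_fun hg (H.lin 1 1 y)
  have hTinj : Function.Injective T := fun y y' h => hH.lin_injective 1 1 (by rw [← hT, h, hT])
  obtain ⟨b, hb, -⟩ := LinearIndependent.exists_prolongation (V := Fin (M 1) → ℂ) (a := fun _ => 0)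
    (q := fun r => Q r 1) (u := fun _ => Fin.elim0) linearIndependent_empty_type
    (fun _ => Nat.zero_le _) (by rwa [finrank_real_of_complex, finrank_fin_fun])
  have hTb := hb.map' (T.restrictScalars ℝ) (LinearMap.ker_eq_bot.2 hTinj)
  -- The vectors `w` must be independent of `T (b 0)` and `T (b 1)`: receiver `1` sees both symbol
  -- blocks of transmitter `1` inside the space of transmitter `0`.
  obtain ⟨w, hw⟩ := hTb.exists_extend_fin (Q 1 0) (by
    rwa [finrank_real_of_complex, finrank_fin_fun, Fintype.card_sum, Fintype.card_fin,
      Fintype.card_fin])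
  let P : Precoders M Q := fun r t => match r, t with
    | 0, 0 => fun i => T (b 0 (Fin.cast hQ0 i))
    | 0, 1 => b 0
    | 1, 0 => w
    | 1, 1 => b 1
  refine ⟨P, fun r t => ?_, fun r i => ?_, fun r => ?_⟩
  · match r, t with
    | 0, 0 => exact hQ0.ge
    | 0, 1 => exact le_rfl
    | 1, _ => exact Nat.zero_le _
  · match r with
    | 0 => exact hT _
    | 1 => exact i.elim0
  · match r with
    | 0 =>
      have hV0 := hw.comp (Sum.elim (fun i => Sum.inl (Sum.inl (Fin.cast hQ0 i))) Sum.inr :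
          Fin (Q 0 0) ⊕ Fin (Q 1 0) → (Fin (Q 0 1) ⊕ Fin (Q 1 1)) ⊕ Fin (Q 1 0)) (by
        rintro (i | i) (j | j) hij
        · simpa using hij
        · simp at hij
        · simp at hij
        · simpa using hij)
      -- Receiver `0` has enough antennas to separate the transmitters, so independence at each
      -- transmitter is enough.
      have hprod := (linearIndependent_inl_union_inr' hV0 hb).map'
        ((Channel.joint 0 H).restrictScalars ℝ) (LinearMap.ker_eq_bot.2 (hH.injective 0 hN0))
      have h2 := hprod.comp (fun j => match j with
        | Sum.inl ⟨0, i⟩ => Sum.inl (Sum.inl i)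
        | Sum.inl ⟨1, i⟩ => Sum.inr (Sum.inl i)
        | Sum.inr (Sum.inl i) => Sum.inl (Sum.inr i)
        | Sum.inr (Sum.inr i) => Sum.inr (Sum.inr i.1) :
        ((t : Fin 2) × Fin (Q 0 t)) ⊕ (Fin (Q 1 0) ⊕ {i : Fin (Q 1 1) // 0 ≤ (i : ℕ)}) →
          (Fin (Q 0 0) ⊕ Fin (Q 1 0)) ⊕ (Fin (Q 0 1) ⊕ Fin (Q 1 1))) (by
        rintro (⟨t, i⟩ | i | ⟨i, hi⟩) (⟨t', j⟩ | j | ⟨j, hj⟩) hij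
        · fin_cases t <;> fin_cases t' <;> simp_all
        all_goals first
          | (fin_cases t <;> simp_all)
          | (fin_cases t' <;> simp_all)
          | simp_all)
      refine h2.of_forall_eq fun j => ?_
      match j with
      | Sum.inl ⟨0, i⟩ => exact Channel.joint_inl H 0 _
      | Sum.inl ⟨1, i⟩ => exact Channel.joint_inr H 0 _
      | Sum.inr (Sum.inl i) => exact Channel.joint_inl H 0 _
      | Sum.inr (Sum.inr i) => exact Channel.joint_inr H 0 _
    | 1 =>
      -- Applying `H.lin 1 0` turns `T (b 1)` into the desired columns of transmitter `1`, and `T (b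
      -- 0)` into the interference, counted once.
      have h2 := (hw.map' ((H.lin 1 0).restrictScalars ℝ)
        (LinearMap.ker_eq_bot.2 (hH.lin_injective 1 0))).comp (fun j => match j with
        | Sum.inl ⟨0, i⟩ => Sum.inr i
        | Sum.inl ⟨1, i⟩ => Sum.inl (Sum.inr i)
        | Sum.inr (Sum.inl i) => Sum.inl (Sum.inl (Fin.cast hQ0 i))
        | Sum.inr (Sum.inr i) => absurd i.2 (not_le.2 i.1.2) :
        ((t : Fin 2) × Fin (Q 1 t)) ⊕ (Fin (Q 0 0) ⊕ {i : Fin (Q 0 1) // Q 0 1 ≤ (i : ℕ)}) →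
          (Fin (Q 0 1) ⊕ Fin (Q 1 1)) ⊕ Fin (Q 1 0)) (by
        rintro (⟨t, i⟩ | i | ⟨i, hi⟩) (⟨t', j⟩ | j | ⟨j, hj⟩) hij
        · fin_cases t <;> fin_cases t' <;> simp_all
        all_goals first
          | omega
          | (fin_cases t <;> simp_all)
          | (fin_cases t' <;> simp_all)
          | simp_all)
      refine h2.of_forall_eq fun j => ?_
      match j with
      | Sum.inl ⟨0, i⟩ => rfl
      | Sum.inl ⟨1, i⟩ => exact hT _
      | Sum.inr (Sum.inl i) => rfl
      | Sum.inr (Sum.inr i) => exact absurd i.2 (not_le.2 i.1.2)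

/-! ### The number of symbols of an alignment scheme -/

section
variable {M N : Fin 2 → ℕ} {Q : Fin 2 → Fin 2 → ℕ} {H : Channel M N} {P : Precoders M Q}
  {a : Fin 2 → ℕ}

open Module in
theorem IsAlignmentScheme.card_receivedColumns_le (h : IsAlignmentScheme H P a) (r : Fin 2) :
    Q r 0 + Q r 1 + (Q r.rev 0 + (Q r.rev 1 - a r.rev)) ≤ 2 * N r := by
  have hle := (h.independent r).fintype_card_le_finrank
  rw [finrank_real_of_complex, finrank_fin_fun, Fintype.card_sum, Fintype.card_sum,
    Fintype.card_sigma, card_subtype_fin_ge] at hle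
  simpa using hle

/-- The interfering symbols of either transmitter and the desired symbols fit into the space of the
receiver. -/
theorem IsAlignmentScheme.length_add_le_receiver (h : IsAlignmentScheme H P a) (r t : Fin 2) :
    Q r 0 + Q r 1 + Q r.rev t ≤ 2 * N r := by
  have h1 := h.card_receivedColumns_le r
  have h2 := h.le_length r.rev 0
  match t with
  | 0 => omega
  | 1 => omega

open Module in
/-- The symbols of a transmitter fit into its space. -/
theorem IsAlignmentScheme.length_add_le_transmitter (h : IsAlignmentScheme H P a) (t : Fin 2) :
    Q 0 t + Q 1 t ≤ 2 * M t := by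
  -- At receiver `0` every interfering symbol of `t` has a listed column with the same value,
  -- possibly that of its aligned partner. Keeping the same index makes the choice injective, so all
  -- precoders of `t` have independent images.
  have hsel : ∀ i : Fin (Q 1 t), ∃ j : Fin (Q 1 0) ⊕ {i : Fin (Q 1 1) // a 1 ≤ (i : ℕ)},
      receivedColumns H P a 0 (Sum.inr j) = H.apply 0 t (P 1 t i) ∧
        (i : ℕ) = Sum.elim (fun k : Fin (Q 1 0) => (k : ℕ))
          (fun k : {i : Fin (Q 1 1) // a 1 ≤ (i : ℕ)} => (k.1 : ℕ)) j := by
    match t with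
    | 0 => exact fun i => ⟨Sum.inl i, rfl, rfl⟩
    | 1 =>
      intro i
      by_cases hi : a 1 ≤ i
      · exact ⟨Sum.inr ⟨i, hi⟩, rfl, rfl⟩
      · refine ⟨Sum.inl ⟨i, (not_le.1 hi).trans_le (h.le_length 1 0)⟩, ?_, rfl⟩
        exact h.aligned 1 ⟨i, not_le.1 hi⟩
  choose j hj hval using hsel
  have hli := (h.independent 0).comp
    (Sum.elim (fun i => Sum.inl ⟨t, i⟩) (fun i => Sum.inr (j i)) :
      Fin (Q 0 t) ⊕ Fin (Q 1 t) → _) (by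
      rintro (i | i) (k | k) hik
      · simpa using hik
      · simp at hik
      · simp at hik
      · have : j i = j k := by simpa using hik
        exact congrArg Sum.inr (Fin.ext ((hval i).trans ((congrArg _ this).trans (hval k).symm))))
  have hcomp : LinearIndependent ℝ
      ((H.lin 0 t).restrictScalars ℝ ∘ Sum.elim (P 0 t) (P 1 t)) := by
    refine hli.of_forall_eq fun i => ?_
    rcases i with i | i
    · rfl
    · exact hj i
  have hle := (hcomp.of_comp _).fintype_card_le_finrank
  rwa [finrank_real_of_complex, finrank_fin_fun, Fintype.card_sum, Fintype.card_fin,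
    Fintype.card_fin] at hle

end

/-! ### The main theorem -/

theorem blockLength_of_eq_of_eq {M N : Fin 2 → ℕ} (h : N 1 = M 0 ∧ M 0 = M 1) :
    blockLength M N = ![![2 * M 1 - 2, 2 * M 1 - 2], ![1, 1]] :=
  if_pos h

theorem blockLength_of_eq_of_ne {M N : Fin 2 → ℕ} (h : N 1 = M 0) (h' : M 0 ≠ M 1) :
    blockLength M N = ![![2 * M 1 - 1, 2 * M 1 - 1], ![2 * (N 1 - M 1), 1]] :=
  (if_neg fun hh => h' hh.2).trans (if_pos h)

theorem blockLength_of_ne {M N : Fin 2 → ℕ} (h : N 1 ≠ M 0) :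
    blockLength M N =
      ![![2 * M 0 - min (2 * (N 1 - M 1)) (M 0), 2 * M 1 - min (2 * (N 1 - M 0)) (M 1)],
        ![min (2 * (N 1 - M 1)) (M 0), min (2 * (N 1 - M 0)) (M 1)]] :=
  (if_neg fun hh => h hh.1).trans (if_neg h)

theorem one_le_blockLength {M N : Fin 2 → ℕ} (hpos : 1 ≤ M 1) (hM : M 1 ≤ M 0) (hMN : M 0 ≤ N 1)
    (hN1 : 1 < N 1) (r t : Fin 2) : 1 ≤ blockLength M N r t := by
  by_cases h : N 1 = M 0
  · by_cases h' : M 0 = M 1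
    · rw [blockLength_of_eq_of_eq ⟨h, h'⟩]
      fin_cases r <;> fin_cases t <;> simp <;> omega
    · rw [blockLength_of_eq_of_ne h h']
      fin_cases r <;> fin_cases t <;> simp <;> omega
  · rw [blockLength_of_ne h]
    fin_cases r <;> fin_cases t <;> simp <;> omega

theorem sum_blockLength {M N : Fin 2 → ℕ} (hpos : 1 ≤ M 1) (hM : M 1 ≤ M 0) (hMN : M 0 ≤ N 1) :
    ∑ r, ∑ t, (blockLength M N r t : ℝ) = 2 * totalDoF M N := by
  have hnat : ∀ (q : Fin 2 → Fin 2 → ℕ) (s : ℕ), q 0 0 + q 0 1 + (q 1 0 + q 1 1) = s →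
      ∑ r, ∑ t, (q r t : ℝ) = s := fun q s h => by
    rw [← h]
    simp [Fin.sum_univ_two]
  by_cases h : N 1 = M 0
  · by_cases h' : M 0 = M 1
    · rw [hnat _ (4 * M 1 - 2) (by rw [blockLength_of_eq_of_eq ⟨h, h'⟩]; simp; omega), totalDoF,
        if_pos ⟨h, h'⟩, Nat.cast_sub (by omega), h']
      push_cast
      ring
    · rw [hnat _ (2 * M 0 + 2 * M 1 - 1) (by rw [blockLength_of_eq_of_ne h h']; simp; omega),
        totalDoF, if_neg fun hh => h' hh.2, if_pos h, Nat.cast_sub (by omega)]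
      push_cast
      ring
  · rw [hnat _ (2 * M 0 + 2 * M 1) (by rw [blockLength_of_ne h]; simp; omega), totalDoF,
      if_neg fun hh => h hh.1, if_neg h]
    push_cast
    ring

theorem Channel.IsGeneric.exists_alignmentScheme {M N : Fin 2 → ℕ} {H : Channel M N}
    (hH : H.IsGeneric) (hpos : 1 ≤ M 1) (hM : M 1 ≤ M 0) (hMN : M 0 ≤ N 1) (hN : N 1 ≤ N 0)
    (hB : 2 * M 0 + M 1 ≤ N 0 + N 1) :
    ∃ (P : Precoders M (blockLength M N)) (a : Fin 2 → ℕ), IsAlignmentScheme H P a := by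
  by_cases h : N 1 = M 0
  · by_cases h' : M 0 = M 1
    · obtain ⟨P, hP⟩ := hH.exists_alignmentScheme_of_eq h (by omega) (Q := blockLength M N)
        (by rw [blockLength_of_eq_of_eq ⟨h, h'⟩]; rfl)
        (by rw [blockLength_of_eq_of_eq ⟨h, h'⟩]; simp; omega)
        (by rw [blockLength_of_eq_of_eq ⟨h, h'⟩]; simp; omega)
      exact ⟨P, _, hP⟩
    · obtain ⟨P, hP⟩ := hH.exists_alignmentScheme_of_eq h (by omega) (Q := blockLength M N)
        (by rw [blockLength_of_eq_of_ne h h']; rfl)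
        (by rw [blockLength_of_eq_of_ne h h']; simp; omega)
        (by rw [blockLength_of_eq_of_ne h h']; simp; omega)
      exact ⟨P, _, hP⟩
  -- The aligned pairs must fit into the blocks. For receiver `0` this follows from `Q 1 t ≤ 2 * (N
  -- 1 - M t.rev)`; for receiver `1` from `N 1 ≤ N 0` and `hB`, which bound `2 * (M 0 + M 1 - N 0)`
  -- by both minima.
  · obtain ⟨P, hP⟩ := hH.exists_full_alignmentScheme (Q := blockLength M N)
      (by
        rw [blockLength_of_ne h]
        intro r t
        fin_cases r <;> fin_cases t <;> simp <;> omega)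
      (by
        rw [blockLength_of_ne h]
        intro t
        fin_cases t <;> simp <;> omega)
    exact ⟨P, _, hP⟩

/-- The transmitter bounds alone give `M 0 + M 1`. If `N 1 = M 0`, adding `Q 1 0 + Q 1 1 + Q 0 0 ≤ 2
* N 1` and `Q 0 1 + Q 1 1 ≤ 2 * M 1` counts `Q 1 1 ≥ 1` twice and saves one symbol. If also `M 0 = M
1`, adding the two bounds at receiver `1` counts both `Q 1 0` and `Q 1 1` twice and saves two. -/
theorem IsAlignmentScheme.sum_length_le {M N : Fin 2 → ℕ} {Q : Fin 2 → Fin 2 → ℕ} {H : Channel M N}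
    {P : Precoders M Q} {a : Fin 2 → ℕ} (h : IsAlignmentScheme H P a) (hQ : ∀ r t, 1 ≤ Q r t) :
    (∑ r, ∑ t, (Q r t : ℝ)) / 2 ≤ totalDoF M N := by
  have h0 := h.length_add_le_transmitter 0
  have h1 := h.length_add_le_transmitter 1
  have h2 : Q 1 0 + Q 1 1 + Q 0 0 ≤ 2 * N 1 := h.length_add_le_receiver 1 0
  have h3 : Q 1 0 + Q 1 1 + Q 0 1 ≤ 2 * N 1 := h.length_add_le_receiver 1 1
  have h4 := hQ 1 0
  have h5 := hQ 1 1
  have hsum : ∑ r, ∑ t, (Q r t : ℝ) = ((Q 0 0 + Q 0 1 + (Q 1 0 + Q 1 1) : ℕ) : ℝ) := by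
    simp [Fin.sum_univ_two]
  rw [hsum, div_le_iff₀ two_pos, totalDoF]
  split_ifs with hc hc'
  · have : Q 0 0 + Q 0 1 + (Q 1 0 + Q 1 1) + 2 ≤ 2 * M 0 + 2 * M 1 := by omega
    have : ((Q 0 0 + Q 0 1 + (Q 1 0 + Q 1 1) : ℕ) : ℝ) + 2 ≤ 2 * M 0 + 2 * M 1 := by
      exact_mod_cast this
    linarith
  · have : Q 0 0 + Q 0 1 + (Q 1 0 + Q 1 1) + 1 ≤ 2 * M 0 + 2 * M 1 := by omega
    have : ((Q 0 0 + Q 0 1 + (Q 1 0 + Q 1 1) : ℕ) : ℝ) + 1 ≤ 2 * M 0 + 2 * M 1 := by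
      exact_mod_cast this
    linarith
  · have : Q 0 0 + Q 0 1 + (Q 1 0 + Q 1 1) ≤ 2 * M 0 + 2 * M 1 := by omega
    have : ((Q 0 0 + Q 0 1 + (Q 1 0 + Q 1 1) : ℕ) : ℝ) ≤ 2 * M 0 + 2 * M 1 := by
      exact_mod_cast this
    linarith

theorem theorem5 (M N : Fin 2 → ℕ) (hpos : 1 ≤ M 1) (hM : M 1 ≤ M 0) (hMN : M 0 ≤ N 1)
    (hN : N 1 ≤ N 0) (hB : 2 * M 0 + M 1 ≤ N 0 + N 1) (v : ℝ≥0) (hv : v ≠ 0) :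
    -- the four blocks are non-empty, except for `N 1 = M 0 = M 1 = 1`
    (1 < N 1 → ∀ r t, 1 ≤ blockLength M N r t) ∧
    -- for almost every channel
    ∀ᵐ H ∂(channelLaw M N v),
      -- the scheme exists with these block lengths, each real message gets `1 / 2` degree of
      -- freedom, and the sum is the claimed value
      (∃ (P : Precoders M (blockLength M N)) (a : Fin 2 → ℕ) (d : ∀ r t, Fin (blockLength M N r t) → ℝ),
        IsAlignmentScheme H P a ∧
        (∀ r t i, d r t i = 1 / 2) ∧
        DoFAchievable H (fun _ => {c | c.UsesPrecoders P}) d ∧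
        ∑ r, ∑ t, ∑ i, d r t i = totalDoF M N) ∧
      -- no scheme with four non-empty blocks gives more
      (∀ (Q : Fin 2 → Fin 2 → ℕ) (P : Precoders M Q) (a : Fin 2 → ℕ),
        (∀ r t, 1 ≤ Q r t) → IsAlignmentScheme H P a →
        (∑ r, ∑ t, (Q r t : ℝ)) / 2 ≤ totalDoF M N) ∧
      -- outer bound: no codes whatsoever give more than `M 0 + M 1`
      (∀ (Q : Fin 2 → Fin 2 → ℕ) (d : ∀ r t, Fin (Q r t) → ℝ),
        DoFAchievable H (fun n => (Set.univ : Set (Code M N Q n))) d →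
        ∑ r, ∑ t, ∑ i, d r t i ≤ (M 0 : ℝ) + M 1) := by
  refine ⟨fun hN1 => one_le_blockLength hpos hM hMN hN1, ?_⟩
  have hMNall : ∀ r t, M t ≤ N r := by
    intro r t
    fin_cases r <;> fin_cases t <;> simp <;> omega
  have hsum : ∀ t : Fin 2, 2 * M t.rev + M t ≤ N 0 + N 1 := by
    intro t
    fin_cases t <;> simp <;> omega
  filter_upwards [ae_isGeneric hv hMNall hsum] with H hH
  refine ⟨?_, fun Q P a hQ h => h.sum_length_le hQ, fun Q d h => sum_le_of_doFAchievable H h⟩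
  obtain ⟨P, a, hP⟩ := hH.exists_alignmentScheme hpos hM hMN hN hB
  refine ⟨P, a, fun _ _ _ => 1 / 2, hP, fun _ _ _ => rfl, hP.doFAchievable, ?_⟩
  have hs := sum_blockLength (M := M) (N := N) hpos hM hMN
  simp only [Finset.sum_const, Finset.card_univ, Fintype.card_fin, nsmul_eq_mul,
    ← Finset.sum_mul]
  rw [hs]
  ring
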